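/- Let $n\ge 1$ and $\lambda_p,\lambda_d,r_d>0$. Let $\Phi$ be the Matérn cluster process on $\mathbb{R}^n$ with these parameters: the parent points $\{X_i\}$ form a homogeneous Poisson point process on $\mathbb{R}^n$ of intensity $\lambda_p$; the daughter processes $\Phi_i$ are i.i.d. Poisson point processes, independent of the parents, with intensity $\lambda_d$ on the closed ball of radius $r_d$ centred at the origin and no points outside it; and $\Phi=\bigcup_i (X_i+\Phi_i)$. For $k\ge1$ let $R_k$ be the distance from an arbitrary fixed point of $\mathbb{R}^n$ to the $k$-th closest point of $\Phi$. Put $v_n=\pi^{n/2}/\Gamma(\tfrac n2+1)$, let $\mathcal{A}(r,r_d,x)$ be the volume of the intersection of two balls of $\mathbb{R}^n$ with radii $r$ and $r_d$ whose centres are at distance $x$, and for $j\ge0$ and $r\ge 0$ let $$h_j(r)=\frac{\lambda_p n v_n}{j!}\int_0^{r+r_d}\bigl(\lambda_d\mathcal{A}(r,r_d,x)\bigr)^j e^{-\lambda_d\mathcal{A}(r,r_d,x)}x^{n-1}\,dx .$$ Then $R_k$ is a random variable, and for every $r\ge0$ its cumulative distribution function $F_{R_k}(r)=\mathbb{P}(R_k\le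 r)$ is $$F_{R_k}(r)=1-e^{h_0(r)-\lambda_p v_n(r+r_d)^n}\sum_{m=0}^{k-1}\ \sum_{(b_1,\dots,b_m)\in B_m}\ \prod_{i=1}^m\frac{h_i(r)^{b_i}}{b_i!},$$ where $B_m$ is the set of all $m$-tuples of non-negative integers with $b_1+2b_2+\dots+m b_m=m$ (so $B_0$ consists of the empty tuple, which contributes $1$). -/

import Mathlib

open MeasureTheory ProbabilityTheory
open scoped ENNReal NNReal

noncomputable section

/-- The counting measure of a configuration `S` of points:
`configMeasure S B` is the number of points of `S` in `B`, for every measurable set `B`. -/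
def configMeasure {E : Type*} [MeasurableSpace E] (S : Set E) : Measure E :=
  Measure.sum fun x : S => Measure.dirac (x : E)

theorem configMeasure_apply {E : Type*} [MeasurableSpace E] (S : Set E) {B : Set E}
    (hB : MeasurableSet B) : configMeasure S B = ((S ∩ B).encard : ℝ≥0∞) := by
  have h1 : configMeasure S B = ∑' x : S, (B.indicator (fun _ => (1 : ℝ≥0∞))) (x : E) := by
    simp [configMeasure, Measure.sum_apply _ hB, Measure.dirac_apply' _ hB, Pi.one_def]
  rw [h1, tsum_subtype S (B.indicator fun _ => (1 : ℝ≥0∞)), Set.indicator_indicator,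
    ← tsum_subtype (S ∩ B) (fun _ => (1 : ℝ≥0∞)), ENNReal.tsum_set_one]

/-- The random set of points `Φ` is a Poisson point process with intensity measure `μ`:
the number of points in each set of finite intensity `μ B` is Poisson distributed with mean `μ B`,
and the numbers of points in pairwise disjoint sets are independent. -/
structure IsPoissonPointProcess {Ω E : Type*} [MeasurableSpace Ω] [MeasurableSpace E]
    (Φ : Ω → Set E) (μ : Measure E) (P : Measure Ω) : Prop where
  measurable : Measurable fun ω => configMeasure (Φ ω)
  law : ∀ B : Set E, MeasurableSet B → μ B ≠ ∞ →
    P.map (fun ω => configMeasure (Φ ω) B)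
      = (poissonMeasure (μ B).toNNReal).map (fun j : ℕ => (j : ℝ≥0∞))
  indep : ∀ (m : ℕ) (B : Fin m → Set E), (∀ j, MeasurableSet (B j)) →
    Pairwise (fun i j => Disjoint (B i) (B j)) →
    iIndepFun (fun (j : Fin m) ω => configMeasure (Φ ω) (B j)) P

/-- `X i` are the parent points and `C i` is the daughter process attached to the parent `X i`
(relative to that parent): the parents form a Poisson point process of constant intensity `lamP`
on `ℝⁿ`, each daughter process is Poisson with intensity `lamD` on the closed ball of radius `rd`
around the origin, and the daughter processes are independent of one another and of the
parents. -/
structure IsMaternClustering {Ω : Type*} [MeasurableSpace Ω] {n : ℕ}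
    (X : ℕ → Ω → EuclideanSpace ℝ (Fin n)) (C : ℕ → Ω → Set (EuclideanSpace ℝ (Fin n)))
    (lamP lamD rd : ℝ) (P : Measure Ω) : Prop where
  measurable_parent : ∀ i, Measurable (X i)
  parent_injective : ∀ᵐ ω ∂P, Function.Injective fun i => X i ω
  parent : IsPoissonPointProcess (fun ω => Set.range fun i => X i ω)
    (ENNReal.ofReal lamP • (volume : Measure (EuclideanSpace ℝ (Fin n)))) P
  daughter : ∀ i, IsPoissonPointProcess (C i)
    (ENNReal.ofReal lamD •
      (volume : Measure (EuclideanSpace ℝ (Fin n))).restrict (Metric.closedBall 0 rd)) P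
  daughter_indep : iIndepFun (fun i ω => configMeasure (C i ω)) P
  parent_indep_daughter :
    IndepFun (fun ω i => X i ω) (fun ω i => configMeasure (C i ω)) P

/-- `Φ` is an `n`-dimensional Matérn cluster process with parent intensity `lamP`, daughter
intensity `lamD` and cluster radius `rd`: it is the union of the daughter processes, each
translated by its parent. -/
def IsMaternClusterProcess {Ω : Type*} [MeasurableSpace Ω] {n : ℕ}
    (Φ : Ω → Set (EuclideanSpace ℝ (Fin n))) (lamP lamD rd : ℝ) (P : Measure Ω) : Prop :=
  ∃ (X : ℕ → Ω → EuclideanSpace ℝ (Fin n)) (C : ℕ → Ω → Set (EuclideanSpace ℝ (Fin n))),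
    IsMaternClustering X C lamP lamD rd P ∧
      ∀ᵐ ω ∂P, Φ ω = ⋃ i, (fun z => X i ω + z) '' C i ω

/-- The distance from `y` to the `k`-th closest point of `S`: the smallest radius of a closed ball
around `y` that contains at least `k` points of `S` (`∞` if `S` has fewer than `k` points). -/
def kthDist {E : Type*} [PseudoMetricSpace E] (k : ℕ) (y : E) (S : Set E) : ℝ≥0∞ :=
  ⨅ (ρ : ℝ≥0) (_ : (k : ℕ∞) ≤ (S ∩ Metric.closedBall y ρ).encard), (ρ : ℝ≥0∞)

/-- The volume `v_n` of the unit ball of `ℝⁿ`. -/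
def unitBallVolume (n : ℕ) : ℝ := Real.pi ^ ((n : ℝ) / 2) / Real.Gamma ((n : ℝ) / 2 + 1)

/-- The volume of the intersection of two balls of `ℝⁿ` with radii `r` and `rd` whose centres, the
origin and a point on the first coordinate axis, are at distance `x`. -/
def interVolume (n : ℕ) [NeZero n] (r rd x : ℝ) : ℝ :=
  (volume : Measure (EuclideanSpace ℝ (Fin n))).real
    (Metric.closedBall 0 r ∩ Metric.closedBall (EuclideanSpace.single 0 x) rd)

/-- The functions `h_k(r)`, for `k = 0` as well. -/
def hCoeff (n : ℕ) [NeZero n] (lamP lamD rd : ℝ) (k : ℕ) (r : ℝ) : ℝ :=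
  lamP * n * unitBallVolume n / k.factorial *
    ∫ x in (0 : ℝ)..(r + rd),
      (lamD * interVolume n r rd x) ^ k * Real.exp (-(lamD * interVolume n r rd x)) * x ^ (n - 1)

/-- The set of all tuples `(b_1, …, b_m)` of natural numbers with `b_1 + 2 b_2 + ⋯ + m b_m = m`
(the entry `b_{i+1}` is `b i`). -/
def tupleSet (m : ℕ) : Finset (Fin m → ℕ) :=
  (Fintype.piFinset fun _ : Fin m => Finset.range (m + 1)).filter
    fun b => ∑ i : Fin m, ((i : ℕ) + 1) * b i = m

theorem mem_tupleSet {m : ℕ} (b : Fin m → ℕ) :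
    b ∈ tupleSet m ↔ ∑ i : Fin m, ((i : ℕ) + 1) * b i = m := by
  simp only [tupleSet, Finset.mem_filter, Fintype.mem_piFinset, Finset.mem_range,
    and_iff_right_iff_imp]
  intro h i
  have h1 : ((i : ℕ) + 1) * b i ≤ ∑ j : Fin m, ((j : ℕ) + 1) * b j :=
    Finset.single_le_sum (f := fun j : Fin m => ((j : ℕ) + 1) * b j)
      (fun _ _ => Nat.zero_le _) (Finset.mem_univ i)
  nlinarith [Nat.zero_le ((i : ℕ) * b i)]

end

/-! Fix `r` and let `N` be the number of points of `Φ` in the closed ball of radius `r` around `y`.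
Since `Φ` is almost surely locally finite, `R_k ≤ r` means `N ≥ k` (`kthDist_le_ofReal_iff`), so it
suffices to find `P(N = m)` for `m < k`; these come from the generating function of `N`.

Almost surely no two clusters share a point (`ae_disjoint_clusters`), so `N` is the sum over `i` of
the number of points of the `i`-th cluster in the ball. Given the parents, these numbers are
independent Poisson variables with means `λ_d A(r, r_d, |y - X_i|)`. Hence `E s^N` is the
expectation of `∏ exp(-(1-s) λ_d A(r, r_d, |y - X_i|))`, a Laplace functional of the parent process.
For a Poisson process this functional is explicit (`integral_expNeg_lintegral`), and polar
coordinates turn the resulting integral into `λ_p v_n (r+r_d)^n - ∑ h_j(r) s^j`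
(`integral_one_sub_exp_interVolume`, `hasSum_hCoeff`). So `E s^N = exp(-λ_p v_n (r+r_d)^n + ∑ h_j(r)
s^j)` for `0 < s < 1`.

It remains to read off the coefficients (`coeff_exp_powerSeries`). The logarithmic derivative gives
a recurrence that determines them, and the sums over the tuples in `B_m` satisfy the same recurrence
(`weightedTuples_recurrence`).

Generating functions are written with `s = e^{-t}` and counts in `[0, ∞]`, so that finiteness is
only needed almost surely. -/

noncomputable section

open Filter Topology

/-! ### The exponential `e^{-u}` for extended nonnegative `u`. -/

/-- The function `u ↦ e^{-u}` on `[0, ∞]`, with value `0` at `∞`. -/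
def expNeg (u : ℝ≥0∞) : ℝ := (EReal.exp (-(u : EReal))).toReal

theorem expNeg_exp_ne_top (u : ℝ≥0∞) : EReal.exp (-(u : EReal)) ≠ ∞ := by
  simp

@[simp] theorem expNeg_zero : expNeg 0 = 1 := by simp [expNeg]

@[simp] theorem expNeg_top : expNeg ∞ = 0 := by simp [expNeg]

theorem expNeg_coe (x : ℝ≥0) : expNeg x = Real.exp (-x) := by
  have h : (((x : ℝ≥0∞) : EReal)) = ((x : ℝ) : EReal) := rfl
  rw [expNeg, h, ← EReal.coe_neg, EReal.exp_coe, ENNReal.toReal_ofReal (Real.exp_nonneg _)]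

theorem expNeg_ofReal {x : ℝ} (hx : 0 ≤ x) : expNeg (ENNReal.ofReal x) = Real.exp (-x) := by
  rw [ENNReal.ofReal, expNeg_coe, Real.coe_toNNReal x hx]

theorem expNeg_nonneg (u : ℝ≥0∞) : 0 ≤ expNeg u := ENNReal.toReal_nonneg

theorem expNeg_le_one (u : ℝ≥0∞) : expNeg u ≤ 1 := by
  induction u with
  | top => simp
  | coe x => rw [expNeg_coe, Real.exp_le_one_iff]; simp

theorem norm_expNeg_le_one (u : ℝ≥0∞) : ‖expNeg u‖ ≤ 1 := by
  rw [Real.norm_of_nonneg (expNeg_nonneg u)]; exact expNeg_le_one u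

theorem expNeg_add (u v : ℝ≥0∞) : expNeg (u + v) = expNeg u * expNeg v := by
  induction u with
  | top => simp
  | coe x =>
    induction v with
    | top => simp
    | coe y =>
      rw [← ENNReal.coe_add, expNeg_coe, expNeg_coe, expNeg_coe, ← Real.exp_add]
      congr 1; push_cast; ring

theorem expNeg_sum {ι : Type*} (s : Finset ι) (u : ι → ℝ≥0∞) :
    expNeg (∑ i ∈ s, u i) = ∏ i ∈ s, expNeg (u i) := by
  classical
  induction s using Finset.induction_on with
  | empty => simp
  | insert i s hi ih => rw [Finset.sum_insert hi, Finset.prod_insert hi, expNeg_add, ih]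

theorem expNeg_mul_natCast (u : ℝ≥0∞) (j : ℕ) : expNeg (u * j) = expNeg u ^ j := by
  rw [mul_comm, ← nsmul_eq_mul, ← Finset.card_range j, ← Finset.sum_const, expNeg_sum,
    Finset.prod_const]

theorem continuous_expNeg : Continuous expNeg := by
  have h : Continuous fun u : ℝ≥0∞ => EReal.exp (-(u : EReal)) :=
    ENNReal.continuous_exp.comp (continuous_neg.comp continuous_coe_ennreal_ereal)
  exact ENNReal.continuousOn_toReal.comp_continuous h expNeg_exp_ne_top

@[fun_prop] theorem measurable_expNeg : Measurable expNeg := continuous_expNeg.measurable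

theorem measurable_expNeg_const_mul (a : ℝ≥0∞) : Measurable fun u => expNeg (a * u) :=
  measurable_expNeg.comp (measurable_const_mul a)

theorem one_sub_expNeg_le (u : ℝ≥0∞) : 1 - expNeg u ≤ 1 := by linarith [expNeg_nonneg u]

theorem one_sub_expNeg_nonneg (u : ℝ≥0∞) : 0 ≤ 1 - expNeg u := by linarith [expNeg_le_one u]

/-! ### Laplace transforms of Poisson variables and Poisson point processes. -/

theorem integral_pow_poissonMeasure (r : ℝ≥0) (q : ℝ) :
    ∫ j : ℕ, q ^ j ∂poissonMeasure r = Real.exp (-((1 - q) * r)) := by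
  rw [integral_poissonMeasure]
  have h := ((NormedSpace.expSeries_div_hasSum_exp ((r : ℝ) * q)).mul_left (Real.exp (-r))).tsum_eq
  rw [← Real.exp_eq_exp_ℝ, ← Real.exp_add] at h
  rw [show -((1 - q) * (r : ℝ)) = -r + r * q by ring, ← h]
  refine tsum_congr fun j => ?_
  rw [smul_eq_mul, mul_pow]; ring

namespace IsPoissonPointProcess

variable {Ω E : Type*} [MeasurableSpace Ω] [MeasurableSpace E] {Φ : Ω → Set E} {μ : Measure E}
  {P : Measure Ω}

theorem measurable_count (h : IsPoissonPointProcess Φ μ P) {B : Set E} (hB : MeasurableSet B) :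
    Measurable fun ω => configMeasure (Φ ω) B :=
  (Measure.measurable_coe hB).comp h.measurable

theorem integral_expNeg_mul_count (h : IsPoissonPointProcess Φ μ P) {B : Set E}
    (hB : MeasurableSet B) (hμ : μ B ≠ ∞) (a : ℝ≥0∞) :
    ∫ ω, expNeg (a * configMeasure (Φ ω) B) ∂P = Real.exp (-((1 - expNeg a) * μ.real B)) := by
  have h1 : ∫ ω, expNeg (a * configMeasure (Φ ω) B) ∂P
      = ∫ u, expNeg (a * u) ∂(P.map fun ω => configMeasure (Φ ω) B) :=
    (integral_map (h.measurable_count hB).aemeasurable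
      (measurable_expNeg_const_mul a).aestronglyMeasurable).symm
  rw [h1, h.law B hB hμ, integral_map (by fun_prop)
    (measurable_expNeg_const_mul a).aestronglyMeasurable]
  simp_rw [expNeg_mul_natCast]
  rw [integral_pow_poissonMeasure]; rfl

theorem ae_count_lt_top (h : IsPoissonPointProcess Φ μ P) {B : Set E}
    (hB : MeasurableSet B) (hμ : μ B ≠ ∞) : ∀ᵐ ω ∂P, configMeasure (Φ ω) B < ∞ := by
  have h1 : ∀ᵐ u ∂(P.map fun ω => configMeasure (Φ ω) B), u < ∞ := by
    rw [h.law B hB hμ, ae_map_iff (by fun_prop) measurableSet_Iio]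
    simp
  exact ae_of_ae_map (h.measurable_count hB).aemeasurable h1

theorem ae_count_eq_zero (h : IsPoissonPointProcess Φ μ P) {B : Set E}
    (hB : MeasurableSet B) (hμ : μ B = 0) : ∀ᵐ ω ∂P, configMeasure (Φ ω) B = 0 := by
  have h1 : ∀ᵐ u ∂(P.map fun ω => configMeasure (Φ ω) B), u = 0 := by
    have h0 : MeasurableSet {u : ℝ≥0∞ | u = 0} := measurableSet_singleton 0
    have h2 : {j : ℕ | (j : ℝ≥0∞) = 0}ᶜ = {0}ᶜ := by ext; simp
    rw [h.law B hB (by simp [hμ]), ae_map_iff (by fun_prop) h0,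
      Filter.Eventually, mem_ae_iff, h2, prob_compl_eq_zero_iff (measurableSet_singleton 0),
      poissonMeasure_singleton, hμ]
    simp
  exact ae_of_ae_map (h.measurable_count hB).aemeasurable h1

/-- The level sets of `f` are disjoint, so the counts in them are independent and the expectation
factors into Laplace transforms of Poisson variables. Only nonzero levels need finite intensity: the
level `0` contributes the factor `1`. -/
theorem integral_expNeg_lintegral_simpleFunc [IsProbabilityMeasure P]
    (h : IsPoissonPointProcess Φ μ P) (f : SimpleFunc E ℝ≥0∞)
    (hf : ∀ a, a ≠ 0 → μ (f ⁻¹' {a}) ≠ ∞) :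
    ∫ ω, expNeg (∫⁻ x, f x ∂configMeasure (Φ ω)) ∂P =
      Real.exp (-∫ x, (1 - expNeg (f x)) ∂μ) := by
  classical
  let e := f.range.equivFin.symm
  let a : Fin f.range.card → ℝ≥0∞ := fun j => e j
  let B : Fin f.range.card → Set E := fun j => f ⁻¹' {a j}
  have hB : ∀ j, MeasurableSet (B j) := fun j => f.measurableSet_preimage _
  have hdisj : Pairwise fun i j => Disjoint (B i) (B j) := by
    intro i j hij
    refine Disjoint.preimage _ (Set.disjoint_singleton.2 fun hh => hij ?_)
    exact e.injective (Subtype.ext hh)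
  have hsum : ∀ g : ℝ≥0∞ → ℝ≥0∞, ∑ u ∈ f.range, g u = ∑ j, g (a j) := by
    intro g
    rw [← Finset.sum_coe_sort, ← e.sum_comp]
  have hl : ∀ ω, expNeg (∫⁻ x, f x ∂configMeasure (Φ ω))
      = ∏ j, expNeg (a j * configMeasure (Φ ω) (B j)) := by
    intro ω
    rw [SimpleFunc.lintegral_eq_lintegral, SimpleFunc.lintegral,
      hsum fun u => u * configMeasure (Φ ω) (f ⁻¹' {u}), expNeg_sum]
  simp_rw [hl]
  rw [(h.indep _ B hB hdisj).integral_fun_prod_comp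
    (f := fun j u => expNeg (a j * u))
    (fun j => (h.measurable_count (hB j)).aemeasurable)
    (fun j => (measurable_expNeg_const_mul (a j)).aestronglyMeasurable)]
  have hfac : ∀ j, ∫ ω, expNeg (a j * configMeasure (Φ ω) (B j)) ∂P
      = Real.exp (-((1 - expNeg (a j)) * μ.real (B j))) := by
    intro j
    by_cases ha : a j = 0
    · simp [ha]
    · exact h.integral_expNeg_mul_count (hB j) (hf _ ha) _
  simp_rw [hfac]
  rw [← Real.exp_sum, Finset.sum_neg_distrib]
  congr 2
  have hpt : ∀ x, 1 - expNeg (f x) =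
      ∑ j, (B j).indicator (fun _ => 1 - expNeg (a j)) x := by
    intro x
    obtain ⟨j, hj⟩ := e.surjective ⟨f x, f.mem_range_self x⟩
    have hj' : f x = a j := by simp [a, hj]
    rw [Finset.sum_eq_single j]
    · rw [Set.indicator_of_mem (by simpa [B] using hj'), hj']
    · intro i _ hij
      refine Set.indicator_of_notMem (fun hx => ?_) _
      exact Set.disjoint_left.1 (hdisj hij) hx (by simpa [B] using hj')
    · simp
  have hint : ∀ j, Integrable ((B j).indicator fun _ => 1 - expNeg (a j)) μ := by
    intro j
    by_cases ha : a j = 0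
    · simp [ha]
    · exact (integrable_indicator_iff (hB j)).2 (integrableOn_const (hf _ ha))
  simp_rw [hpt]
  rw [integral_finsetSum _ fun j _ => hint j]
  refine Finset.sum_congr rfl fun j _ => ?_
  rw [integral_indicator_const _ (hB j), smul_eq_mul, mul_comm]

/-- The Laplace functional of a Poisson point process. -/
theorem integral_expNeg_lintegral [IsProbabilityMeasure P]
    (h : IsPoissonPointProcess Φ μ P) {f : E → ℝ≥0∞} (hf : Measurable f) {S : Set E}
    (hS : MeasurableSet S) (hμS : μ S ≠ ∞) (hfS : ∀ x ∉ S, f x = 0) :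
    ∫ ω, expNeg (∫⁻ x, f x ∂configMeasure (Φ ω)) ∂P =
      Real.exp (-∫ x, (1 - expNeg (f x)) ∂μ) := by
  have hle : ∀ n x, SimpleFunc.eapprox f n x ≤ f x := by
    intro n x
    rw [← SimpleFunc.iSup_eapprox_apply hf x]
    exact le_iSup (fun n => SimpleFunc.eapprox f n x) n
  have hsupp : ∀ n, ∀ x ∉ S, SimpleFunc.eapprox f n x = 0 := fun n x hx =>
    le_antisymm ((hle n x).trans (hfS x hx).le) zero_le
  have hn : ∀ n, ∫ ω, expNeg (∫⁻ x, SimpleFunc.eapprox f n x ∂configMeasure (Φ ω)) ∂P =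
      Real.exp (-∫ x, (1 - expNeg (SimpleFunc.eapprox f n x)) ∂μ) := by
    refine fun n => h.integral_expNeg_lintegral_simpleFunc _ fun a ha => ?_
    refine measure_ne_top_of_subset (fun x hx => ?_) hμS
    by_contra hxS
    exact ha (by rw [← hsupp n x hxS]; exact hx.symm)
  have hL : Tendsto (fun n => ∫ ω, expNeg (∫⁻ x, SimpleFunc.eapprox f n x ∂configMeasure (Φ ω)) ∂P)
      atTop (𝓝 (∫ ω, expNeg (∫⁻ x, f x ∂configMeasure (Φ ω)) ∂P)) := by
    refine tendsto_integral_of_dominated_convergence (fun _ => 1) (fun n => ?_)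
      (integrable_const 1) (fun n => ae_of_all _ fun ω => norm_expNeg_le_one _)
      (ae_of_all _ fun ω => ?_)
    · exact (measurable_expNeg.comp ((Measure.measurable_lintegral
        (SimpleFunc.eapprox f n).measurable).comp h.measurable)).aestronglyMeasurable
    · refine (continuous_expNeg.tendsto _).comp ?_
      refine lintegral_tendsto_of_tendsto_of_monotone
        (fun n => (SimpleFunc.eapprox f n).measurable.aemeasurable)
        (ae_of_all _ fun x m n hmn => SimpleFunc.monotone_eapprox f hmn x)
        (ae_of_all _ fun x => SimpleFunc.tendsto_eapprox hf x)
  have hR : Tendsto (fun n => Real.exp (-∫ x, (1 - expNeg (SimpleFunc.eapprox f n x)) ∂μ))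
      atTop (𝓝 (Real.exp (-∫ x, (1 - expNeg (f x)) ∂μ))) := by
    refine (Real.continuous_exp.tendsto _).comp (Tendsto.neg ?_)
    -- The integrand is at most `1` and vanishes off `S`, so the indicator of `S` dominates even if
    -- `μ` is infinite.
    refine tendsto_integral_of_dominated_convergence (S.indicator fun _ => 1) (fun n => ?_)
      ((integrable_indicator_iff hS).2 (integrableOn_const hμS))
      (fun n => ae_of_all _ fun x => ?_) (ae_of_all _ fun x => ?_)
    · exact (measurable_const.sub (measurable_expNeg.comp
        (SimpleFunc.eapprox f n).measurable)).aestronglyMeasurable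
    · rw [Real.norm_of_nonneg (one_sub_expNeg_nonneg _)]
      by_cases hx : x ∈ S
      · rw [Set.indicator_of_mem hx]; exact one_sub_expNeg_le _
      · rw [hsupp n x hx, Set.indicator_of_notMem hx]; simp
    · exact tendsto_const_nhds.sub
        ((continuous_expNeg.tendsto _).comp (SimpleFunc.tendsto_eapprox hf x))
  simp_rw [hn] at hL
  exact tendsto_nhds_unique hL hR

end IsPoissonPointProcess

/-! ### Power series: logarithmic derivative and recurrence. -/

theorem hasFPowerSeriesAt_ofScalars_of_hasSum {c : ℕ → ℝ} {f : ℝ → ℝ}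
    (h : ∀ᶠ s in 𝓝 (0 : ℝ), HasSum (fun m => c m * s ^ m) (f s)) :
    HasFPowerSeriesAt f (FormalMultilinearSeries.ofScalars ℝ c) 0 := by
  rw [hasFPowerSeriesAt_iff]
  filter_upwards [h] with s hs
  simpa [mul_comm] using hs

theorem iteratedDeriv_eq_of_hasSum {c : ℕ → ℝ} {f : ℝ → ℝ}
    (h : ∀ᶠ s in 𝓝 (0 : ℝ), HasSum (fun m => c m * s ^ m) (f s)) (m : ℕ) :
    iteratedDeriv m f 0 = m.factorial * c m := by
  have h1 := hasFPowerSeriesAt_ofScalars_of_hasSum h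
  have h2 := h1.eq_formalMultilinearSeries h1.analyticAt.hasFPowerSeriesAt
  have h3 := congrArg (fun p => FormalMultilinearSeries.coeff p m) h2
  simp only [FormalMultilinearSeries.coeff_ofScalars] at h3
  rw [h3]; field_simp

/-- If `∑ p_m s^m = exp (c + ∑ a_j s^j)` for small positive `s`, then the coefficients `p_m`
satisfy the recurrence that comes from comparing logarithmic derivatives. -/
theorem coeff_recurrence_of_eq_exp {p a : ℕ → ℝ} {G H : ℝ → ℝ} {c : ℝ}
    (hG : ∀ᶠ s in 𝓝 (0 : ℝ), HasSum (fun m => p m * s ^ m) (G s))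
    (hH : ∀ᶠ s in 𝓝 (0 : ℝ), HasSum (fun m => a m * s ^ m) (H s))
    (hGH : ∀ᶠ s in 𝓝[>] (0 : ℝ), G s = Real.exp (c + H s)) :
    p 0 = Real.exp (c + a 0) ∧
    ∀ m : ℕ, (m + 1 : ℝ) * p (m + 1) =
      ∑ i ∈ Finset.range (m + 1), (i + 1 : ℝ) * a (i + 1) * p (m - i) := by
  have hGa := (hasFPowerSeriesAt_ofScalars_of_hasSum hG).analyticAt
  have hHa := (hasFPowerSeriesAt_ofScalars_of_hasSum hH).analyticAt
  have hEa : AnalyticAt ℝ (fun s => Real.exp (c + H s)) 0 := (analyticAt_const.add hHa).rexp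
  have hev : G =ᶠ[𝓝 0] fun s => Real.exp (c + H s) := by
    -- Identity theorem: equality on a right neighbourhood of `0` spreads to a full neighbourhood,
    -- where derivatives at `0` can be compared.
    refine (hGa.frequently_eq_iff_eventually_eq hEa).1 ?_
    exact (hGH.frequently).filter_mono (nhdsWithin_mono _ fun s hs => ne_of_gt hs)
  have hG0 := iteratedDeriv_eq_of_hasSum hG
  have hH0 := iteratedDeriv_eq_of_hasSum hH
  refine ⟨?_, fun m => ?_⟩
  · have h1 := hG0 0
    have h2 := hH0 0
    simp only [iteratedDeriv_zero, Nat.factorial_zero, Nat.cast_one, one_mul] at h1 h2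
    rw [← h1, ← h2, hev.eq_of_nhds]
  -- `G' = H' G`; the Leibniz rule for its `m`-th derivative at `0` is the recurrence, up to
  -- factorials.
  · have hd : deriv G =ᶠ[𝓝 0] fun s => deriv H s * G s := by
      filter_upwards [hev.eventuallyEq_nhds, hHa.eventually_analyticAt] with s hs hHs
      rw [hs.deriv_eq, hs.eq_of_nhds]
      have := (hHs.differentiableAt.hasDerivAt.const_add c).exp
      rw [this.deriv, mul_comm]
    have h1 : iteratedDeriv (m + 1) G 0 = ∑ i ∈ Finset.range (m + 1),
        m.choose i * iteratedDeriv (i + 1) H 0 * iteratedDeriv (m - i) G 0 := by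
      rw [iteratedDeriv_succ', hd.iteratedDeriv_eq m,
        iteratedDeriv_fun_mul hHa.deriv.contDiffAt hGa.contDiffAt]
      simp_rw [iteratedDeriv_succ']
    rw [hG0] at h1
    simp_rw [hG0, hH0] at h1
    have hm : (m.factorial : ℝ) ≠ 0 := by positivity
    refine mul_left_cancel₀ hm ?_
    rw [Finset.mul_sum]
    calc (m.factorial : ℝ) * ((m + 1) * p (m + 1)) = (m + 1).factorial * p (m + 1) := by
          rw [Nat.factorial_succ]; push_cast; ring
      _ = _ := h1
      _ = _ := by
        refine Finset.sum_congr rfl fun i hi => ?_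
        have hi' : i ≤ m := Nat.lt_succ_iff.1 (Finset.mem_range.1 hi)
        rw [← Nat.choose_mul_factorial_mul_factorial hi', Nat.factorial_succ]
        push_cast; ring

/-! ### Combinatorics of weighted tuples. -/

/-- The tuples `(b_1, …, b_M)` of natural numbers with `b_1 + 2 b_2 + ⋯ + M b_M = m`. -/
def weightedTuples (M m : ℕ) : Finset (Fin M → ℕ) :=
  (Fintype.piFinset fun _ : Fin M => Finset.range (m + 1)).filter
    fun b => ∑ i : Fin M, ((i : ℕ) + 1) * b i = m

theorem mem_weightedTuples {M m : ℕ} (b : Fin M → ℕ) :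
    b ∈ weightedTuples M m ↔ ∑ i : Fin M, ((i : ℕ) + 1) * b i = m := by
  simp only [weightedTuples, Finset.mem_filter, Fintype.mem_piFinset, Finset.mem_range,
    and_iff_right_iff_imp]
  intro h i
  have h1 : ((i : ℕ) + 1) * b i ≤ ∑ j : Fin M, ((j : ℕ) + 1) * b j :=
    Finset.single_le_sum (f := fun j : Fin M => ((j : ℕ) + 1) * b j)
      (fun _ _ => Nat.zero_le _) (Finset.mem_univ i)
  nlinarith [Nat.zero_le ((i : ℕ) * b i)]

/-- The contribution of the tuple `b` to the coefficients of the exponential of the power series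
with coefficients `a`. -/
def tupleWeight (a : ℕ → ℝ) {M : ℕ} (b : Fin M → ℕ) : ℝ :=
  ∏ i : Fin M, a ((i : ℕ) + 1) ^ b i / (b i).factorial

/-- A nonzero last entry would contribute at least `M + 1 > m` to the weighted sum, so it is zero
and can be dropped. This lets tuples of different weights be compared at a common length. -/
theorem sum_weightedTuples_succ (a : ℕ → ℝ) {M m : ℕ} (h : m ≤ M) :
    ∑ b ∈ weightedTuples (M + 1) m, tupleWeight a b = ∑ b ∈ weightedTuples M m, tupleWeight a b := by
  symm
  refine Finset.sum_bij' (fun b _ => Fin.snoc (α := fun _ => ℕ) b 0) (fun b _ => Fin.init b)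
    (fun b hb => ?_) (fun b hb => ?_) (fun b _ => Fin.init_snoc _ _) (fun b hb => ?_)
    (fun b _ => ?_)
  · rw [mem_weightedTuples] at hb ⊢
    simpa [Fin.sum_univ_castSucc] using hb
  all_goals try
    have h0 : b (Fin.last M) = 0 := by
      rw [mem_weightedTuples, Fin.sum_univ_castSucc] at hb
      by_contra h1
      have h2 : M + 1 ≤ (M + 1) * b (Fin.last M) := Nat.le_mul_of_pos_right _ (by omega)
      simp only [Fin.val_last] at hb
      omega
  · rw [mem_weightedTuples] at hb ⊢
    simpa [Fin.sum_univ_castSucc, h0, Fin.init] using hb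
  · rw [← h0]; exact Fin.snoc_init_self b
  · simp [tupleWeight, Fin.prod_univ_castSucc]

theorem sum_weightedTuples_of_le (a : ℕ → ℝ) {M m : ℕ} (h : m ≤ M) :
    ∑ b ∈ weightedTuples M m, tupleWeight a b = ∑ b ∈ weightedTuples m m, tupleWeight a b := by
  induction M, h using Nat.le_induction with
  | base => rfl
  | succ M h ih => rw [sum_weightedTuples_succ a h, ih]

theorem tupleWeight_update (a : ℕ → ℝ) {M : ℕ} (b : Fin M → ℕ) (i : Fin M) :
    (b i + 1 : ℝ) * tupleWeight a (Function.update b i (b i + 1)) =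
      a ((i : ℕ) + 1) * tupleWeight a b := by
  have h1 : ∀ b' : Fin M → ℕ, tupleWeight a b' = a ((i : ℕ) + 1) ^ b' i / (b' i).factorial *
      ∏ j ∈ Finset.univ.erase i, a ((j : ℕ) + 1) ^ b' j / (b' j).factorial := fun b' =>
    (Finset.mul_prod_erase _ _ (Finset.mem_univ i)).symm
  have h2 : ∏ j ∈ Finset.univ.erase i, a ((j : ℕ) + 1) ^ (Function.update b i (b i + 1) j) /
        ((Function.update b i (b i + 1) j).factorial : ℝ) =
      ∏ j ∈ Finset.univ.erase i, a ((j : ℕ) + 1) ^ b j / ((b j).factorial : ℝ) :=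
    Finset.prod_congr rfl fun j hj => by
      rw [Function.update_of_ne (Finset.ne_of_mem_erase hj)]
  rw [h1, h2, h1 b, Function.update_self, Nat.factorial_succ]
  have : ((b i).factorial : ℝ) ≠ 0 := by positivity
  push_cast
  field_simp
  ring

theorem weight_update {M : ℕ} (b : Fin M → ℕ) (i : Fin M) (v : ℕ) :
    (∑ j : Fin M, ((j : ℕ) + 1) * Function.update b i v j) + ((i : ℕ) + 1) * b i =
      (∑ j : Fin M, ((j : ℕ) + 1) * b j) + ((i : ℕ) + 1) * v := by
  rw [← Finset.add_sum_erase _ _ (Finset.mem_univ i),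
    ← Finset.add_sum_erase _ (fun j : Fin M => ((j : ℕ) + 1) * b j) (Finset.mem_univ i),
    Function.update_self]
  have h2 : ∑ j ∈ Finset.univ.erase i, ((j : ℕ) + 1) * Function.update b i v j =
      ∑ j ∈ Finset.univ.erase i, ((j : ℕ) + 1) * b j :=
    Finset.sum_congr rfl fun j hj => by
      rw [Function.update_of_ne (Finset.ne_of_mem_erase hj)]
  rw [h2]; ring

/-- The factor `b i` removes the tuples with `b i = 0`; on the others, lowering `b i` by one is a
bijection onto the tuples of weight `m - i`, because entry `i` carries weight `i + 1`. The factor `b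
i` cancels against the factorial. -/
theorem sum_mul_tupleWeight (a : ℕ → ℝ) {M m : ℕ} (i : Fin M) (hi : (i : ℕ) ≤ m) :
    ∑ b ∈ weightedTuples M (m + 1), (b i : ℝ) * tupleWeight a b =
      a ((i : ℕ) + 1) * ∑ b ∈ weightedTuples M (m - i), tupleWeight a b := by
  rw [Finset.mul_sum]
  have h0 : ∑ b ∈ (weightedTuples M (m + 1)).filter (fun b => b i ≠ 0),
        (b i : ℝ) * tupleWeight a b =
      ∑ b ∈ weightedTuples M (m + 1), (b i : ℝ) * tupleWeight a b := by
    refine Finset.sum_filter_of_ne fun b _ hb h => hb (by simp [h])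
  rw [← h0]
  symm
  refine Finset.sum_bij' (fun b _ => Function.update b i (b i + 1))
    (fun b _ => Function.update b i (b i - 1))
    (fun b hb => ?_) (fun b hb => ?_) (fun b _ => by simp) (fun b hb => ?_) (fun b _ => ?_)
  · rw [mem_weightedTuples] at hb
    rw [Finset.mem_filter, mem_weightedTuples]
    have := weight_update b i (b i + 1)
    refine ⟨?_, by simp⟩
    rw [mul_add] at this
    omega
  · rw [Finset.mem_filter, mem_weightedTuples] at hb
    rw [mem_weightedTuples]
    have := weight_update b i (b i - 1)
    obtain ⟨k, hk⟩ := Nat.exists_eq_succ_of_ne_zero hb.2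
    rw [hk, Nat.succ_sub_one, Nat.succ_eq_add_one, mul_add] at this
    rw [hk, Nat.succ_sub_one]
    omega
  · rw [Finset.mem_filter] at hb
    have : b i - 1 + 1 = b i := Nat.succ_pred_eq_of_ne_zero hb.2
    simp [this]
  · rw [← tupleWeight_update]; simp

/-- On tuples of weight `m + 1` the factor `m + 1` equals `∑ (i + 1) b_i`; exchanging the two sums
leaves one instance of `sum_mul_tupleWeight` for each `i`. -/
theorem weightedTuples_recurrence (a : ℕ → ℝ) (m : ℕ) :
    (m + 1 : ℝ) * ∑ b ∈ weightedTuples (m + 1) (m + 1), tupleWeight a b =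
      ∑ i ∈ Finset.range (m + 1),
        (i + 1 : ℝ) * a (i + 1) * ∑ b ∈ weightedTuples (m - i) (m - i), tupleWeight a b := by
  have h1 : ∀ b ∈ weightedTuples (m + 1) (m + 1), (m + 1 : ℝ) * tupleWeight a b =
      ∑ i : Fin (m + 1), ((i : ℕ) + 1 : ℝ) * ((b i : ℝ) * tupleWeight a b) := by
    intro b hb
    rw [mem_weightedTuples] at hb
    have h2 : (∑ i : Fin (m + 1), ((i : ℕ) + 1 : ℝ) * b i) = m + 1 := by exact_mod_cast hb
    rw [← h2, Finset.sum_mul]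
    exact Finset.sum_congr rfl fun i _ => by ring
  rw [Finset.mul_sum, Finset.sum_congr rfl h1, Finset.sum_comm,
    ← Fin.sum_univ_eq_sum_range fun i =>
      (i + 1 : ℝ) * a (i + 1) * ∑ b ∈ weightedTuples (m - i) (m - i), tupleWeight a b]
  refine Finset.sum_congr rfl fun i _ => ?_
  rw [← Finset.mul_sum, sum_mul_tupleWeight a i (Nat.lt_succ_iff.1 i.2), ← mul_assoc,
    sum_weightedTuples_of_le a (show m - (i : ℕ) ≤ m + 1 by omega)]

/-- The coefficients of the exponential of a power series. -/
theorem coeff_exp_powerSeries {p a : ℕ → ℝ} {G H : ℝ → ℝ} {c : ℝ}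
    (hG : ∀ᶠ s in 𝓝 (0 : ℝ), HasSum (fun m => p m * s ^ m) (G s))
    (hH : ∀ᶠ s in 𝓝 (0 : ℝ), HasSum (fun m => a m * s ^ m) (H s))
    (hGH : ∀ᶠ s in 𝓝[>] (0 : ℝ), G s = Real.exp (c + H s)) (m : ℕ) :
    p m = Real.exp (c + a 0) *
      ∑ b ∈ tupleSet m, ∏ i : Fin m, a ((i : ℕ) + 1) ^ b i / (b i).factorial := by
  obtain ⟨h0, hrec⟩ := coeff_recurrence_of_eq_exp hG hH hGH
  change p m = Real.exp (c + a 0) * ∑ b ∈ weightedTuples m m, tupleWeight a b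
  induction m using Nat.strong_induction_on with
  | _ m ih =>
    cases m with
    | zero =>
      have h : weightedTuples 0 0 = {Fin.elim0} := by
        ext b; simp [mem_weightedTuples, eq_iff_true_of_subsingleton]
      simp [h, tupleWeight, h0]
    | succ m =>
      have hm : (m + 1 : ℝ) ≠ 0 := by positivity
      refine mul_left_cancel₀ hm ?_
      rw [hrec, mul_left_comm, weightedTuples_recurrence, Finset.mul_sum]
      refine Finset.sum_congr rfl fun i _ => ?_
      rw [ih (m - i) (by omega)]; ring

/-! ### Distance to the `k`-th closest point versus the count in a ball. -/

/-- Local finiteness makes the infimum attained: just beyond `r` there is a shell free of points, so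
a ball slightly larger than `r` holds no more points than the ball of radius `r`. -/
theorem kthDist_le_ofReal_iff {E : Type*} [PseudoMetricSpace E] {S : Set E} {y : E}
    (hS : ∀ ρ : ℝ, (S ∩ Metric.closedBall y ρ).Finite) (k : ℕ) {r : ℝ} (hr : 0 ≤ r) :
    kthDist k y S ≤ ENNReal.ofReal r ↔ (k : ℕ∞) ≤ (S ∩ Metric.closedBall y r).encard := by
  constructor
  · intro h
    by_contra hk
    have hT : ((S ∩ Metric.closedBall y (r + 1)) \ Metric.closedBall y r).Finite :=
      (hS (r + 1)).subset Set.sdiff_subset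
    -- `d` is the smallest distance in `(r, r + 1]` realised by a point, or `r + 1` if there is
    -- none.
    obtain ⟨d, hrd, hd⟩ : ∃ d : ℝ, r < d ∧
        ∀ z ∈ S ∩ Metric.closedBall y (r + 1), dist z y ≤ r ∨ d ≤ dist z y ∧ d ≤ r + 1 := by
      by_cases hne : ((S ∩ Metric.closedBall y (r + 1)) \ Metric.closedBall y r).Nonempty
      · obtain ⟨z, hz, hzmin⟩ := Set.exists_min_image _ (fun z => dist z y) hT hne
        refine ⟨dist z y, by simpa using hz.2, fun w hw => ?_⟩
        by_cases hwr : dist w y ≤ r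
        · exact Or.inl hwr
        · exact Or.inr ⟨hzmin w ⟨hw, hwr⟩, hz.1.2⟩
      · refine ⟨r + 1, by linarith, fun w hw => Or.inl ?_⟩
        by_contra hwr
        exact hne ⟨w, hw, hwr⟩
    have hlt : ENNReal.ofReal r < ENNReal.ofReal (min d (r + 1)) :=
      (ENNReal.ofReal_lt_ofReal_iff (lt_min (by linarith) (by linarith))).2 (lt_min hrd (by linarith))
    refine absurd (lt_of_lt_of_le hlt ?_) (not_lt.2 h)
    refine le_iInf₂ fun ρ hρ => ?_
    rw [ENNReal.ofReal_le_iff_le_toReal ENNReal.coe_ne_top, ENNReal.coe_toReal]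
    by_contra hlt'
    rw [not_le, lt_min_iff] at hlt'
    refine hk (hρ.trans (Set.encard_le_encard fun z hz => ⟨hz.1, ?_⟩))
    have hzρ : dist z y ≤ ρ := hz.2
    rcases hd z ⟨hz.1, by rw [Metric.mem_closedBall]; linarith⟩ with h1 | h1
    · exact h1
    · linarith [h1.1]
  · intro h
    have : kthDist k y S ≤ (r.toNNReal : ℝ≥0∞) :=
      iInf₂_le (f := fun (ρ : ℝ≥0) (_ : (k : ℕ∞) ≤ (S ∩ Metric.closedBall y ρ).encard) =>
        (ρ : ℝ≥0∞)) r.toNNReal (by rwa [Real.coe_toNNReal r hr])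
    exact this

/-! ### Volumes of balls and of their intersections. -/

theorem volume_real_unitBall (n : ℕ) [NeZero n] :
    (volume : Measure (EuclideanSpace ℝ (Fin n))).real (Metric.ball 0 1) = unitBallVolume n := by
  have hpos : 0 < Real.Gamma ((n : ℝ) / 2 + 1) := Real.Gamma_pos_of_pos (by positivity)
  rw [Measure.real, EuclideanSpace.volume_ball, ENNReal.ofReal_one, one_pow, one_mul,
    ENNReal.toReal_ofReal (by positivity), unitBallVolume, Fintype.card_fin,
    Real.sqrt_eq_rpow, ← Real.rpow_natCast, ← Real.rpow_mul Real.pi_pos.le]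
  congr 2; ring

theorem volume_real_closedBall (n : ℕ) [NeZero n] (x : EuclideanSpace ℝ (Fin n)) {r : ℝ}
    (hr : 0 ≤ r) :
    (volume : Measure (EuclideanSpace ℝ (Fin n))).real (Metric.closedBall x r) =
      unitBallVolume n * r ^ n := by
  rw [Measure.addHaar_real_closedBall _ x hr, volume_real_unitBall, finrank_euclideanSpace_fin,
    mul_comm]

theorem exists_linearIsometryEquiv_eq {E : Type*} [NormedAddCommGroup E] [InnerProductSpace ℝ E]
    {v w : E} (h : ‖v‖ = ‖w‖) : ∃ T : E ≃ₗᵢ[ℝ] E, T v = w :=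
  ⟨_, Submodule.reflection_sub h⟩

/-- The volume of the intersection of two balls only depends on the radii and on the distance of
the centres. -/
theorem volume_real_closedBall_inter_closedBall (n : ℕ) [NeZero n] (r rd : ℝ)
    (v : EuclideanSpace ℝ (Fin n)) :
    (volume : Measure (EuclideanSpace ℝ (Fin n))).real
      (Metric.closedBall v r ∩ Metric.closedBall 0 rd) = interVolume n r rd ‖v‖ := by
  -- The isometry `z ↦ T (z - v)` takes `v` to the origin and the origin to the point at distance
  -- `‖v‖` on the first axis.
  obtain ⟨T, hT⟩ := exists_linearIsometryEquiv_eq (v := -v)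
    (w := EuclideanSpace.single (0 : Fin n) ‖v‖) (by simp)
  have hmp : MeasurePreserving (fun z => T (z + -v))
      (volume : Measure (EuclideanSpace ℝ (Fin n))) volume :=
    T.measurePreserving.comp (measurePreserving_add_right volume (-v))
  rw [interVolume, ← hmp.measureReal_preimage
    (s := Metric.closedBall 0 r ∩ Metric.closedBall (EuclideanSpace.single 0 ‖v‖) rd)
    (Metric.isClosed_closedBall.inter Metric.isClosed_closedBall).measurableSet.nullMeasurableSet]
  congr 1
  ext z
  have h2 : dist (T (z + -v)) (EuclideanSpace.single 0 ‖v‖) = dist z 0 := by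
    rw [← hT, T.dist_map, dist_eq_norm, dist_zero_right]; congr 1; abel
  have h3 : dist (T (z + -v)) 0 = dist z v := by
    rw [dist_zero_right, T.norm_map, dist_eq_norm, sub_eq_add_neg]
  simp only [Set.mem_inter_iff, Metric.mem_closedBall, Set.mem_preimage, h2, h3]

theorem interVolume_nonneg (n : ℕ) [NeZero n] (r rd x : ℝ) : 0 ≤ interVolume n r rd x :=
  measureReal_nonneg

theorem interVolume_le (n : ℕ) [NeZero n] {r : ℝ} (hr : 0 ≤ r) (rd x : ℝ) :
    interVolume n r rd x ≤ unitBallVolume n * r ^ n := by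
  rw [← volume_real_closedBall n 0 hr]
  exact measureReal_mono Set.inter_subset_left measure_closedBall_lt_top.ne

theorem interVolume_eq_zero (n : ℕ) [NeZero n] {r rd x : ℝ} (h : r + rd < x) :
    interVolume n r rd x = 0 := by
  rw [interVolume, Set.disjoint_iff_inter_eq_empty.1, measureReal_empty]
  refine Metric.closedBall_disjoint_closedBall ?_
  simpa using h.trans_le (le_abs_self x)

theorem measurable_interVolume (n : ℕ) [NeZero n] (r rd : ℝ) :
    Measurable (interVolume n r rd) := by
  have hs : MeasurableSet {q : ℝ × EuclideanSpace ℝ (Fin n) | q.2 ∈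
      Metric.closedBall 0 r ∩ Metric.closedBall (EuclideanSpace.single 0 q.1) rd} := by
    refine IsClosed.measurableSet (IsClosed.inter ?_ ?_)
    · exact isClosed_le (by fun_prop) (by fun_prop)
    · refine isClosed_le (f := fun q : ℝ × EuclideanSpace ℝ (Fin n) =>
        dist q.2 (EuclideanSpace.single 0 q.1)) ?_ (by fun_prop)
      have : (fun x : ℝ => EuclideanSpace.single (0 : Fin n) x) =
          fun x => x • EuclideanSpace.single 0 1 := by
        ext x i; simp
      have hc : Continuous fun x : ℝ => EuclideanSpace.single (0 : Fin n) x := by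
        rw [this]; fun_prop
      fun_prop
  exact (measurable_measure_prodMk_left hs).ennreal_toReal

/-! ### The generating function of the `h_j` and the parent integral. -/

/-- The generating function of the sequence `hCoeff n lamP lamD rd j r`. -/
def hGenFun (n : ℕ) [NeZero n] (lamP lamD rd r s : ℝ) : ℝ :=
  lamP * n * unitBallVolume n *
    ∫ x in (0 : ℝ)..(r + rd), Real.exp (-((1 - s) * (lamD * interVolume n r rd x))) * x ^ (n - 1)

/-- Expand `exp(-(1-s)u) = e^{-u} ∑ (s u)^j / j!` with `u = λ_d A` and integrate term by term. As
`u` is bounded by `V`, an exponential series dominates for every real `s`. -/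
theorem hasSum_hCoeff (n : ℕ) [NeZero n] (lamP : ℝ) {lamD rd r : ℝ} (hD : 0 ≤ lamD)
    (hrd : 0 ≤ rd) (hr : 0 ≤ r) (s : ℝ) :
    HasSum (fun j => hCoeff n lamP lamD rd j r * s ^ j) (hGenFun n lamP lamD rd r s) := by
  set V : ℝ := lamD * (unitBallVolume n * r ^ n)
  have hm := measurable_interVolume n r rd
  have hA0 : ∀ x, 0 ≤ lamD * interVolume n r rd x := fun x =>
    mul_nonneg hD (interVolume_nonneg n r rd x)
  have hAV : ∀ x, lamD * interVolume n r rd x ≤ V := fun x =>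
    mul_le_mul_of_nonneg_left (interVolume_le n hr rd x) hD
  have hsum : ∀ u : ℝ, HasSum (fun j : ℕ => u ^ j / j.factorial) (Real.exp u) := fun u => by
    rw [Real.exp_eq_exp_ℝ]; exact NormedSpace.expSeries_div_hasSum_exp u
  have key : HasSum (fun j : ℕ => ∫ x in (0 : ℝ)..(r + rd),
        (s * (lamD * interVolume n r rd x)) ^ j / j.factorial *
          (Real.exp (-(lamD * interVolume n r rd x)) * x ^ (n - 1)))
      (∫ x in (0 : ℝ)..(r + rd), Real.exp (s * (lamD * interVolume n r rd x)) *
          (Real.exp (-(lamD * interVolume n r rd x)) * x ^ (n - 1))) := by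
    refine intervalIntegral.hasSum_integral_of_dominated_convergence
      (fun j _ => (|s| * V) ^ j / j.factorial * (r + rd) ^ (n - 1))
      (fun j => ?_) (fun j => ae_of_all _ fun x hx => ?_)
      (ae_of_all _ fun x _ => ((hsum _).mul_right _).summable) ?_
      (ae_of_all _ fun x _ => (hsum _).mul_right _)
    · exact Measurable.aestronglyMeasurable (by fun_prop)
    · rw [Set.uIoc_of_le (by positivity)] at hx
      rw [norm_mul, norm_div, norm_pow, norm_mul, Real.norm_of_nonneg (hA0 x), norm_mul,
        Real.norm_of_nonneg (Real.exp_nonneg _), Real.norm_of_nonneg (pow_nonneg hx.1.le _),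
        Real.norm_natCast]
      have h1 : Real.exp (-(lamD * interVolume n r rd x)) ≤ 1 :=
        Real.exp_le_one_iff.2 (by linarith [hA0 x])
      have h2 : x ^ (n - 1) ≤ (r + rd) ^ (n - 1) := pow_le_pow_left₀ hx.1.le hx.2 _
      have h3 : Real.exp (-(lamD * interVolume n r rd x)) * x ^ (n - 1) ≤ (r + rd) ^ (n - 1) := by
        calc _ ≤ 1 * x ^ (n - 1) := by gcongr; exact pow_nonneg hx.1.le _
          _ ≤ _ := by rwa [one_mul]
      have h4 := hA0 x
      have h5 := hAV x
      have hV : 0 ≤ V := h4.trans h5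
      rw [Real.norm_eq_abs]
      have h6 : 0 ≤ Real.exp (-(lamD * interVolume n r rd x)) * x ^ (n - 1) :=
        mul_nonneg (Real.exp_nonneg _) (pow_nonneg hx.1.le _)
      gcongr
    · simp_rw [((hsum (|s| * V)).mul_right _).tsum_eq]
      exact intervalIntegrable_const
  have h1 : ∀ j, hCoeff n lamP lamD rd j r * s ^ j = lamP * n * unitBallVolume n *
      ∫ x in (0 : ℝ)..(r + rd), (s * (lamD * interVolume n r rd x)) ^ j / j.factorial *
          (Real.exp (-(lamD * interVolume n r rd x)) * x ^ (n - 1)) := by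
    intro j
    rw [hCoeff, div_mul_eq_mul_div, mul_div_assoc, mul_assoc _ _ (s ^ j),
      div_mul_eq_mul_div, ← intervalIntegral.integral_mul_const,
      ← intervalIntegral.integral_div]
    congr 2; ext x; rw [mul_pow s]; ring
  have h2 : hGenFun n lamP lamD rd r s = lamP * n * unitBallVolume n *
      ∫ x in (0 : ℝ)..(r + rd), Real.exp (s * (lamD * interVolume n r rd x)) *
          (Real.exp (-(lamD * interVolume n r rd x)) * x ^ (n - 1)) := by
    rw [hGenFun]
    congr 2; ext x; rw [← mul_assoc (Real.exp _), ← Real.exp_add]; congr 2; ring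
  simp_rw [h1, h2]
  exact key.mul_left _

/-- Translate `y` to the origin and use polar coordinates. The integrand vanishes beyond radius `r +
rd`, where the two balls are disjoint; below it, the term `1` gives the volume of a ball and the
exponential gives `hGenFun`. -/
theorem integral_one_sub_exp_interVolume (n : ℕ) [NeZero n] {lamP lamD rd r q : ℝ}
    (hP : 0 ≤ lamP) (hD : 0 ≤ lamD) (hrd : 0 ≤ rd) (hr : 0 ≤ r) (hq : 0 ≤ q)
    (y : EuclideanSpace ℝ (Fin n)) :
    ∫ x, (1 - Real.exp (-(q * (lamD * interVolume n r rd ‖y - x‖))))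
        ∂(ENNReal.ofReal lamP • (volume : Measure (EuclideanSpace ℝ (Fin n)))) =
      lamP * unitBallVolume n * (r + rd) ^ n - hGenFun n lamP lamD rd r (1 - q) := by
  have hm := measurable_interVolume n r rd
  have hn : (n : ℝ) ≠ 0 := by exact_mod_cast NeZero.ne n
  have hA0 : ∀ x, 0 ≤ q * (lamD * interVolume n r rd x) := fun x =>
    mul_nonneg hq (mul_nonneg hD (interVolume_nonneg n r rd x))
  rw [integral_smul_measure, ENNReal.toReal_ofReal hP,
    integral_sub_left_eq_self (fun x => 1 - Real.exp (-(q * (lamD * interVolume n r rd ‖x‖))))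
      volume y,
    integral_fun_norm_addHaar volume
      (fun x => 1 - Real.exp (-(q * (lamD * interVolume n r rd x)))),
    volume_real_unitBall, finrank_euclideanSpace_fin]
  have hset : ∫ x in Set.Ioi (0 : ℝ), x ^ (n - 1) •
        (1 - Real.exp (-(q * (lamD * interVolume n r rd x)))) =
      ∫ x in (0 : ℝ)..(r + rd), x ^ (n - 1) •
        (1 - Real.exp (-(q * (lamD * interVolume n r rd x)))) := by
    rw [intervalIntegral.integral_of_le (by positivity)]
    refine setIntegral_eq_of_subset_of_forall_sdiff_eq_zero measurableSet_Ioi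
      Set.Ioc_subset_Ioi_self fun x hx => ?_
    have : r + rd < x := by
      by_contra h
      exact hx.2 ⟨hx.1, not_lt.1 h⟩
    simp [interVolume_eq_zero n this]
  have hi : IntervalIntegrable (fun x : ℝ =>
      Real.exp (-(q * (lamD * interVolume n r rd x))) * x ^ (n - 1)) volume 0 (r + rd) := by
    refine (intervalIntegrable_const (c := (r + rd) ^ (n - 1))).mono_fun
      (Measurable.aestronglyMeasurable (by fun_prop)) ?_
    rw [Set.uIoc_of_le (by positivity)]
    refine (ae_restrict_mem measurableSet_Ioc).mono fun x hx => ?_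
    beta_reduce
    rw [norm_mul, Real.norm_of_nonneg (Real.exp_nonneg _),
      Real.norm_of_nonneg (pow_nonneg hx.1.le _), Real.norm_of_nonneg (by positivity)]
    calc _ ≤ 1 * x ^ (n - 1) := by
          gcongr
          · exact pow_nonneg hx.1.le _
          · exact Real.exp_le_one_iff.2 (by linarith [hA0 x])
      _ ≤ _ := by rw [one_mul]; exact pow_le_pow_left₀ hx.1.le hx.2 _
  have hsplit : ∫ x in (0 : ℝ)..(r + rd), x ^ (n - 1) •
        (1 - Real.exp (-(q * (lamD * interVolume n r rd x)))) =
      (r + rd) ^ n / n - ∫ x in (0 : ℝ)..(r + rd),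
        Real.exp (-(q * (lamD * interVolume n r rd x))) * x ^ (n - 1) := by
    have h1 : ∫ x in (0 : ℝ)..(r + rd), x ^ (n - 1) = (r + rd) ^ n / n := by
      have h2 : n - 1 + 1 = n := Nat.succ_pred_eq_of_ne_zero (NeZero.ne n)
      rw [integral_pow, h2, zero_pow (NeZero.ne n), sub_zero]
      congr 1
      exact_mod_cast h2
    rw [← h1, ← intervalIntegral.integral_sub (intervalIntegral.intervalIntegrable_pow _) hi]
    congr 1; ext x; rw [smul_eq_mul]; ring
  rw [hset, hsplit, hGenFun, sub_sub_cancel]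
  simp only [smul_eq_mul, nsmul_eq_mul]
  field_simp

/-! ### A kernel that makes functions of random measures measurable. -/

section Kernel

variable {E : Type*} [MeasurableSpace E]

theorem measurableSet_measure_univ_lt_top : MeasurableSet {μ : Measure E | μ Set.univ < ∞} :=
  measurableSet_lt (Measure.measurable_coe MeasurableSet.univ) measurable_const

open Classical in
/-- The tautological kernel from measures on `E` to `E`, set to zero at the infinite measures. -/
def finiteMeasureKernel (E : Type*) [MeasurableSpace E] : Kernel (Measure E) E where
  toFun μ := if μ Set.univ < ∞ then μ else 0
  measurable' := Measurable.ite measurableSet_measure_univ_lt_top measurable_id measurable_const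

theorem finiteMeasureKernel_apply {μ : Measure E} (h : μ Set.univ < ∞) :
    finiteMeasureKernel E μ = μ := by
  classical exact if_pos h

theorem finiteMeasureKernel_le (μ : Measure E) : finiteMeasureKernel E μ ≤ μ := by
  classical
  change (if μ Set.univ < ∞ then μ else 0) ≤ μ
  split_ifs
  · exact le_rfl
  · exact Measure.zero_le μ

open Classical in
/-- The part of `finiteMeasureKernel E` that lives on the measures of total mass in
`[m, m + 1)`. -/
def finiteMeasureKernelPiece (E : Type*) [MeasurableSpace E] (m : ℕ) : Kernel (Measure E) E where
  toFun μ := if μ Set.univ < ∞ ∧ ⌊(μ Set.univ).toReal⌋₊ = m then μ else 0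
  measurable' := by
    refine Measurable.ite (measurableSet_measure_univ_lt_top.inter ?_) measurable_id
      measurable_const
    exact (Nat.measurable_floor.comp
      (Measure.measurable_coe MeasurableSet.univ).ennreal_toReal) (measurableSet_singleton m)

instance (m : ℕ) : IsFiniteKernel (finiteMeasureKernelPiece E m) := by
  classical
  refine ⟨⟨ENNReal.ofReal (m + 1), ENNReal.ofReal_lt_top, fun μ => ?_⟩⟩
  change (if μ Set.univ < ∞ ∧ ⌊(μ Set.univ).toReal⌋₊ = m then μ else 0) Set.univ ≤ _
  split_ifs with h
  · rw [← ENNReal.ofReal_toReal h.1.ne, ← h.2]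
    exact ENNReal.ofReal_le_ofReal (Nat.lt_floor_add_one _).le
  · simp

/-- S-finiteness is what joint measurability of `κ a {z | (a, z) ∈ t}` needs. Sorting the finite
measures by the integer part of their total mass splits the kernel into finite ones. -/
instance : IsSFiniteKernel (finiteMeasureKernel E) := by
  classical
  refine ⟨finiteMeasureKernelPiece E, fun m => inferInstance, ?_⟩
  ext μ s hs
  rw [Kernel.sum_apply' _ _ hs]
  by_cases h : μ Set.univ < ∞
  · rw [finiteMeasureKernel_apply h, tsum_eq_single ⌊(μ Set.univ).toReal⌋₊]
    · change _ = (if μ Set.univ < ∞ ∧ _ = _ then μ else 0) s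
      rw [if_pos ⟨h, rfl⟩]
    · intro m hm
      change (if μ Set.univ < ∞ ∧ _ = _ then μ else 0) s = 0
      rw [if_neg fun h' => hm h'.2.symm]; rfl
  · have h1 : ∀ m, finiteMeasureKernelPiece E m μ s = 0 := fun m => by
      change (if μ Set.univ < ∞ ∧ _ = _ then μ else 0) s = 0
      rw [if_neg fun h' => h h'.1]; rfl
    simp_rw [h1, tsum_zero]
    change (if μ Set.univ < ∞ then μ else 0) s = 0
    rw [if_neg h]; rfl

end Kernel

/-! ### Freezing one of two independent variables (Fubini). -/

section Independence

variable {Ω α β : Type*} [MeasurableSpace Ω] [MeasurableSpace α] [MeasurableSpace β]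
  {P : Measure Ω} [IsProbabilityMeasure P] {U : Ω → α} {V : Ω → β}

theorem ProbabilityTheory.IndepFun.ae_prodMk (h : IndepFun U V P) (hU : Measurable U)
    (hV : Measurable V) {p : α → β → Prop} (hp : MeasurableSet {q : α × β | p q.1 q.2})
    (hUV : ∀ u, ∀ᵐ ω ∂P, p u (V ω)) : ∀ᵐ ω ∂P, p (U ω) (V ω) := by
  have : IsProbabilityMeasure (P.map U) := Measure.isProbabilityMeasure_map hU.aemeasurable
  have : IsProbabilityMeasure (P.map V) := Measure.isProbabilityMeasure_map hV.aemeasurable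
  have h1 : ∀ᵐ q ∂(P.map fun ω => (U ω, V ω)), p q.1 q.2 := by
    rw [(indepFun_iff_map_prod_eq_prod_map_map hU.aemeasurable hV.aemeasurable).1 h,
      Measure.ae_prod_iff_ae_ae hp]
    refine ae_of_all _ fun u => ?_
    exact (ae_map_iff hV.aemeasurable (measurable_prodMk_left hp)).2 (hUV u)
  exact ae_of_ae_map (hU.prodMk hV).aemeasurable h1

theorem ProbabilityTheory.IndepFun.integral_prodMk (h : IndepFun U V P) (hU : Measurable U)
    (hV : Measurable V) {F : α × β → ℝ} (hF : Measurable F) (hF1 : ∀ q, ‖F q‖ ≤ 1) :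
    ∫ ω, F (U ω, V ω) ∂P = ∫ ω, ∫ ω', F (U ω, V ω') ∂P ∂P := by
  have : IsProbabilityMeasure (P.map U) := Measure.isProbabilityMeasure_map hU.aemeasurable
  have : IsProbabilityMeasure (P.map V) := Measure.isProbabilityMeasure_map hV.aemeasurable
  have hi : Integrable F ((P.map U).prod (P.map V)) :=
    Integrable.of_bound hF.aestronglyMeasurable 1 (ae_of_all _ hF1)
  have h1 : ∀ u, ∫ v, F (u, v) ∂(P.map V) = ∫ ω', F (u, V ω') ∂P := fun u =>
    integral_map hV.aemeasurable (hF.comp measurable_prodMk_left).aestronglyMeasurable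
  rw [← integral_map (f := F) (hU.prodMk hV).aemeasurable hF.aestronglyMeasurable,
    (indepFun_iff_map_prod_eq_prod_map_map hU.aemeasurable hV.aemeasurable).1 h,
    integral_prod _ hi, integral_map hU.aemeasurable
      hi.aestronglyMeasurable.integral_prod_right']
  simp_rw [h1]

end Independence

/-! ### Common points of two clusters. -/

section Collision

variable {E : Type*} [NormedAddCommGroup E] [MeasurableSpace E] [BorelSpace E]
  [SecondCountableTopology E]

/-- The number of atoms of `x₁ + μ₁` in the closed ball around `y`, a jointly measurable function
of the parent and the daughter process. -/
def clusterCount (y : E) (ρ : ℝ) (x : E) (μ : Measure E) : ℝ≥0∞ :=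
  finiteMeasureKernel E μ (Metric.closedBall (y - x) ρ)

theorem measurable_clusterCount (y : E) (ρ : ℝ) :
    Measurable fun q : E × Measure E => clusterCount y ρ q.1 q.2 := by
  have ht : MeasurableSet {q : (E × Measure E) × E | dist q.2 (y - q.1.1) ≤ ρ} :=
    measurableSet_le (by fun_prop) measurable_const
  exact Kernel.measurable_kernel_prodMk_left
    (κ := (finiteMeasureKernel E).comap Prod.snd measurable_snd) ht

/-- The number of common atoms of `x₁ + μ₁` and `x₂ + μ₂`. -/
def collisionCount (x₁ x₂ : E) (μ₁ μ₂ : Measure E) : ℝ≥0∞ :=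
  ∫⁻ z, finiteMeasureKernel E μ₂ {x₁ + z - x₂} ∂finiteMeasureKernel E μ₁

theorem measurable_collisionIntegrand :
    Measurable fun q : ((E × E) × Measure E × Measure E) × E =>
      finiteMeasureKernel E q.1.2.2 {q.1.1.1 + q.2 - q.1.1.2} := by
  have ht : MeasurableSet {q : (((E × E) × Measure E × Measure E) × E) × E |
      q.2 = q.1.1.1.1 + q.1.2 - q.1.1.1.2} := by
    refine measurableSet_eq_fun (by fun_prop) (by fun_prop)
  exact Kernel.measurable_kernel_prodMk_left
    (κ := (finiteMeasureKernel E).comap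
      (fun q : ((E × E) × Measure E × Measure E) × E => q.1.2.2) (by fun_prop)) ht

theorem measurable_collisionCount :
    Measurable fun q : (E × E) × Measure E × Measure E =>
      collisionCount q.1.1 q.1.2 q.2.1 q.2.2 :=
  Measurable.lintegral_kernel_prod_right
    (κ := (finiteMeasureKernel E).comap
      (fun q : (E × E) × Measure E × Measure E => q.2.1) (by fun_prop))
    (f := fun q z => finiteMeasureKernel E q.2.2 {q.1.1 + z - q.1.2})
    measurable_collisionIntegrand

/-- With the parents and the first configuration fixed, Fubini reduces the expected number of
collisions to the probabilities that the second process charges a given point, which are zero. -/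
theorem ae_collisionCount_eq_zero {Ω : Type*} [MeasurableSpace Ω] {P : Measure Ω}
    [IsProbabilityMeasure P] {M : Ω → Measure E} (hM : Measurable M)
    (hatom : ∀ z, ∀ᵐ ω ∂P, M ω {z} = 0) (x₁ x₂ : E) (μ₁ : Measure E) :
    ∀ᵐ ω ∂P, collisionCount x₁ x₂ μ₁ (M ω) = 0 := by
  have hm : Measurable fun q : Ω × E => finiteMeasureKernel E (M q.1) {x₁ + q.2 - x₂} :=
    measurable_collisionIntegrand.comp
      (f := fun q : Ω × E => (((x₁, x₂), μ₁, M q.1), q.2)) (by fun_prop)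
  have h0 : ∫⁻ ω, collisionCount x₁ x₂ μ₁ (M ω) ∂P = 0 := by
    unfold collisionCount
    rw [lintegral_lintegral_swap hm.aemeasurable]
    refine lintegral_eq_zero_of_ae_eq_zero (ae_of_all _ fun z => ?_)
    refine lintegral_eq_zero_of_ae_eq_zero ?_
    filter_upwards [hatom (x₁ + z - x₂)] with ω hω
    exact le_antisymm ((finiteMeasureKernel_le _ _).trans hω.le) zero_le
  exact (lintegral_eq_zero_iff (measurable_collisionCount.comp
    (f := fun ω => ((x₁, x₂), μ₁, M ω)) (by fun_prop))).1 h0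

/-- A common point `x₁ + z = x₂ + w` would be an atom `z` of the first measure at which the
integrand is `1`. -/
theorem disjoint_of_collisionCount_eq_zero {x₁ x₂ : E} {S₁ S₂ : Set E}
    (h₁ : configMeasure S₁ Set.univ < ∞) (h₂ : configMeasure S₂ Set.univ < ∞)
    (h : collisionCount x₁ x₂ (configMeasure S₁) (configMeasure S₂) = 0) :
    Disjoint ((fun z => x₁ + z) '' S₁) ((fun z => x₂ + z) '' S₂) := by
  rw [Set.disjoint_left]
  rintro _ ⟨z, hz, rfl⟩ ⟨w, hw, hwz⟩
  have hwz' : x₁ + z - x₂ = w := by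
    rw [← show x₂ + w = x₁ + z from hwz]; abel
  rw [collisionCount, finiteMeasureKernel_apply h₁, finiteMeasureKernel_apply h₂] at h
  have h1 : ∀ {S : Set E} {z : E}, z ∈ S → configMeasure S {z} = 1 := by
    intro S z hz
    rw [configMeasure_apply S (measurableSet_singleton z),
      Set.inter_eq_right.2 (Set.singleton_subset_iff.2 hz)]
    simp
  have hm : Measurable fun z => configMeasure S₂ {x₁ + z - x₂} := by
    have := measurable_collisionIntegrand.comp
      (f := fun z : E => (((x₁, x₂), configMeasure S₁, configMeasure S₂), z)) (by fun_prop)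
    simpa only [Function.comp_def, finiteMeasureKernel_apply h₂] using this
  have h2 := (ae_iff.1 ((lintegral_eq_zero_iff hm).1 h))
  have h3 : configMeasure S₁ {z} ≤ 0 := by
    rw [← h2]
    refine measure_mono (Set.singleton_subset_iff.2 ?_)
    simp [hwz', h1 hw]
  simp [h1 hz] at h3

end Collision

/-! ### Counting the points of a union of clusters. -/

theorem Set.encard_iUnion_eq_tsum {E ι : Type*} [Countable ι] {S : ι → Set E}
    (hS : Pairwise fun i j => Disjoint (S i) (S j)) :
    (((⋃ i, S i).encard : ℕ∞) : ℝ≥0∞) = ∑' i, ((S i).encard : ℝ≥0∞) := by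
  let _ : MeasurableSpace E := ⊤
  have h := measure_iUnion (μ := (Measure.count : Measure E)) hS
    fun i => MeasurableSpace.measurableSet_top
  simpa only [Measure.count_apply MeasurableSpace.measurableSet_top] using h

theorem finite_of_configMeasure_lt_top {E : Type*} [MeasurableSpace E] {S B : Set E}
    (hB : MeasurableSet B)
    (h : configMeasure S B < ∞) : (S ∩ B).Finite := by
  rw [configMeasure_apply S hB] at h
  rw [← Set.encard_lt_top_iff]
  exact_mod_cast h

theorem lintegral_configMeasure_range {E : Type*} [MeasurableSpace E] {X : ℕ → E}
    (hinj : Function.Injective X) {f : E → ℝ≥0∞} (hf : Measurable f) : ∫⁻ x, f x ∂configMeasure (Set.range X) = ∑' i, f (X i) := by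
  rw [configMeasure, lintegral_sum_measure]
  simp_rw [lintegral_dirac' _ hf]
  exact tsum_range f hinj

section Clusters

variable {E : Type*} [NormedAddCommGroup E] [MeasurableSpace E] [BorelSpace E]

theorem encard_image_add_inter_closedBall (x y : E) (C : Set E) (ρ : ℝ)
    (hC : configMeasure C Set.univ < ∞) :
    ((((fun z => x + z) '' C ∩ Metric.closedBall y ρ).encard : ℕ∞) : ℝ≥0∞) =
      clusterCount y ρ x (configMeasure C) := by
  have h : (fun z => x + z) '' C ∩ Metric.closedBall y ρ =
      (fun z => x + z) '' (C ∩ Metric.closedBall (y - x) ρ) := by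
    rw [← Set.image_inter_preimage]
    congr 2; ext z
    simp only [Set.mem_preimage, Metric.mem_closedBall, dist_eq_norm]
    rw [show x + z - y = z - (y - x) by abel]
  rw [h, (add_right_injective x).encard_image, clusterCount, finiteMeasureKernel_apply hC,
    configMeasure_apply _ Metric.isClosed_closedBall.measurableSet]

theorem encard_iUnion_clusters {X : ℕ → E} {C : ℕ → Set E}
    (hfin : ∀ i, configMeasure (C i) Set.univ < ∞)
    (hdisj : Pairwise fun i j =>
      Disjoint ((fun z => X i + z) '' C i) ((fun z => X j + z) '' C j)) (y : E) (ρ : ℝ) :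
    ((((⋃ i, (fun z => X i + z) '' C i) ∩ Metric.closedBall y ρ).encard : ℕ∞) : ℝ≥0∞) =
      ∑' i, clusterCount y ρ (X i) (configMeasure (C i)) := by
  rw [Set.iUnion_inter, Set.encard_iUnion_eq_tsum]
  · exact tsum_congr fun i => encard_image_add_inter_closedBall _ _ _ _ (hfin i)
  · exact fun i j hij => (hdisj hij).mono Set.inter_subset_left Set.inter_subset_left

theorem finite_iUnion_clusters {X : ℕ → E} {C : ℕ → Set E} {rd : ℝ}
    (hinj : Function.Injective X) (hfin : ∀ i, configMeasure (C i) Set.univ < ∞)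
    (hsupp : ∀ i, configMeasure (C i) (Metric.closedBall 0 rd)ᶜ = 0) (y : E)
    (hloc : ∀ m : ℕ, configMeasure (Set.range X) (Metric.closedBall y m) < ∞) (ρ : ℝ) :
    ((⋃ i, (fun z => X i + z) '' C i) ∩ Metric.closedBall y ρ).Finite := by
  -- A cluster reaches the ball of radius `ρ` only if its parent is within `ρ + rd` of `y`; an
  -- integer radius allows countably many almost sure statements to suffice.
  obtain ⟨m, hm⟩ := exists_nat_ge (ρ + rd)
  have hI : {i | X i ∈ Metric.closedBall y m}.Finite := by
    have h1 := finite_of_configMeasure_lt_top Metric.isClosed_closedBall.measurableSet (hloc m)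
    refine (h1.preimage hinj.injOn).subset fun i hi => ⟨⟨i, rfl⟩, hi⟩
  have hCf : ∀ i, (C i).Finite := fun i => by
    simpa using finite_of_configMeasure_lt_top MeasurableSet.univ (hfin i)
  refine (hI.biUnion fun i _ => (hCf i).image fun z => X i + z).subset ?_
  rintro p ⟨hp, hpy⟩
  obtain ⟨i, z, hz, rfl⟩ := Set.mem_iUnion.1 hp
  refine Set.mem_biUnion (x := i) ?_ ⟨z, hz, rfl⟩
  have hzrd : ‖z‖ ≤ rd := by
    by_contra hcon
    have h1 := hsupp i
    rw [configMeasure_apply _ Metric.isClosed_closedBall.measurableSet.compl] at h1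
    have h2 : (C i ∩ (Metric.closedBall 0 rd)ᶜ).encard = 0 := by exact_mod_cast h1
    rw [Set.encard_eq_zero] at h2
    exact (Set.ext_iff.1 h2 z).1 ⟨hz, by simpa using hcon⟩
  have h3 : dist (X i) y ≤ dist (X i) (X i + z) + dist (X i + z) y := dist_triangle _ _ _
  rw [dist_self_add_right] at h3
  have h4 : dist (X i + z) y ≤ ρ := hpy
  change dist (X i) y ≤ m
  linarith

end Clusters

/-- Each sublevel set agrees almost surely with a measurable event about a count. `Φ` itself need
not be measurable, so only null-measurability is available. -/
theorem aemeasurable_kthDist {Ω E : Type*} [MeasurableSpace Ω] [PseudoMetricSpace E]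
    {P : Measure Ω} {Φ : Ω → Set E} {y : E} {k : ℕ} {N : ℝ → Ω → ℝ≥0∞}
    (hN : ∀ r, Measurable (N r))
    (hΦN : ∀ r, ∀ᵐ ω ∂P, (((Φ ω ∩ Metric.closedBall y r).encard : ℕ∞) : ℝ≥0∞) = N r ω)
    (hfin : ∀ᵐ ω ∂P, ∀ r : ℝ, (Φ ω ∩ Metric.closedBall y r).Finite) :
    AEMeasurable (fun ω => kthDist k y (Φ ω)) P := by
  refine NullMeasurable.aemeasurable (measurable_of_Iic
    (f := fun ω : NullMeasurableSpace Ω P => kthDist k y (Φ ω)) fun t => ?_)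
  change NullMeasurableSet {ω | kthDist k y (Φ ω) ≤ t} P
  induction t with
  | top => simp
  | coe t =>
    have h1 : MeasurableSet {ω | (k : ℝ≥0∞) ≤ N t ω} := measurableSet_le measurable_const (hN t)
    refine h1.nullMeasurableSet.congr ?_
    filter_upwards [hΦN t, hfin] with ω h2 h3
    have h4 := kthDist_le_ofReal_iff h3 k t.2
    rw [NNReal.val_eq_coe, ENNReal.ofReal_coe_nnreal] at h4
    refine propext (Iff.symm (h4.trans ?_))
    change _ ↔ (k : ℝ≥0∞) ≤ N t ω
    rw [← h2]
    exact_mod_cast Iff.rfl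

/-! ### Almost sure structure of the Matérn process. -/

namespace IsMaternClustering

variable {Ω : Type*} [MeasurableSpace Ω] {P : Measure Ω} {n : ℕ} {lamP lamD rd : ℝ} {X : ℕ → Ω → EuclideanSpace ℝ (Fin n)}
  {C : ℕ → Ω → Set (EuclideanSpace ℝ (Fin n))}

theorem daughterIntensity_ne_top (lamD rd : ℝ) (B : Set (EuclideanSpace ℝ (Fin n))) :
    (ENNReal.ofReal lamD • (volume : Measure (EuclideanSpace ℝ (Fin n))).restrict
      (Metric.closedBall 0 rd)) B ≠ ∞ := by
  refine ENNReal.mul_ne_top ENNReal.ofReal_ne_top ?_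
  exact ((measure_mono (Set.subset_univ B)).trans_lt (by
    exact (Measure.restrict_apply_univ (μ := volume) _).trans_lt measure_closedBall_lt_top)).ne

theorem parentIntensity_ne_top (lamP : ℝ) (y : EuclideanSpace ℝ (Fin n)) (r : ℝ) :
    (ENNReal.ofReal lamP • (volume : Measure (EuclideanSpace ℝ (Fin n))))
      (Metric.closedBall y r) ≠ ∞ :=
  ENNReal.mul_ne_top ENNReal.ofReal_ne_top measure_closedBall_lt_top.ne

theorem ae_daughter_finite (h : IsMaternClustering X C lamP lamD rd P) :
    ∀ᵐ ω ∂P, ∀ i, configMeasure (C i ω) Set.univ < ∞ :=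
  ae_all_iff.2 fun i => (h.daughter i).ae_count_lt_top MeasurableSet.univ
    (daughterIntensity_ne_top _ _ _)

/-- For each pair `i ≠ j`, freeze the parents by independence, then freeze the `i`-th daughter
process. The `j`-th one charges no fixed point, since its intensity is diffuse. -/
theorem ae_disjoint_clusters [IsProbabilityMeasure P] [NeZero n]
    (h : IsMaternClustering X C lamP lamD rd P) :
    ∀ᵐ ω ∂P, Pairwise fun i j =>
      Disjoint ((fun z => X i ω + z) '' C i ω) ((fun z => X j ω + z) '' C j ω) := by
  have hM : ∀ i, Measurable fun ω => configMeasure (C i ω) := fun i => (h.daughter i).measurable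
  have hatom : ∀ i z, ∀ᵐ ω ∂P, configMeasure (C i ω) {z} = 0 := fun i z =>
    (h.daughter i).ae_count_eq_zero (measurableSet_singleton z) (by simp)
  have hcol : ∀ i j, i ≠ j → ∀ᵐ ω ∂P,
      collisionCount (X i ω) (X j ω) (configMeasure (C i ω)) (configMeasure (C j ω)) = 0 := by
    intro i j hij
    refine h.parent_indep_daughter.ae_prodMk
      (p := fun x M => collisionCount (x i) (x j) (M i) (M j) = 0)
      (measurable_pi_lambda _ h.measurable_parent) (measurable_pi_lambda _ hM)
      ((measurable_collisionCount.comp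
        (f := fun q : (ℕ → EuclideanSpace ℝ (Fin n)) × (ℕ → Measure (EuclideanSpace ℝ (Fin n))) =>
          ((q.1 i, q.1 j), q.2 i, q.2 j)) (by fun_prop)) (measurableSet_singleton 0))
      fun x => ?_
    refine (h.daughter_indep.indepFun hij).ae_prodMk
      (p := fun μ₁ μ₂ => collisionCount (x i) (x j) μ₁ μ₂ = 0) (hM i) (hM j)
      ((measurable_collisionCount.comp
        (f := fun q : Measure (EuclideanSpace ℝ (Fin n)) × Measure (EuclideanSpace ℝ (Fin n)) =>
          ((x i, x j), q.1, q.2)) (by fun_prop)) (measurableSet_singleton 0))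
      fun μ₁ => ae_collisionCount_eq_zero (hM j) (hatom j) _ _ _
  have hcol' : ∀ᵐ ω ∂P, ∀ i j, i ≠ j →
      collisionCount (X i ω) (X j ω) (configMeasure (C i ω)) (configMeasure (C j ω)) = 0 := by
    simp_rw [ae_all_iff]; exact hcol
  filter_upwards [hcol', h.ae_daughter_finite] with ω h1 h2 i j hij
  exact disjoint_of_collisionCount_eq_zero (h2 i) (h2 j) (h1 i j hij)

theorem ae_locallyFinite (h : IsMaternClustering X C lamP lamD rd P)
    (y : EuclideanSpace ℝ (Fin n)) : ∀ᵐ ω ∂P, ∀ r : ℝ,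
      ((⋃ i, (fun z => X i ω + z) '' C i ω) ∩ Metric.closedBall y r).Finite := by
  have h1 : ∀ᵐ ω ∂P, ∀ i, configMeasure (C i ω) (Metric.closedBall 0 rd)ᶜ = 0 :=
    ae_all_iff.2 fun i => (h.daughter i).ae_count_eq_zero
      Metric.isClosed_closedBall.measurableSet.compl
      (by simp [Measure.restrict_apply Metric.isClosed_closedBall.measurableSet.compl])
  have h2 : ∀ᵐ ω ∂P, ∀ m : ℕ,
      configMeasure (Set.range fun i => X i ω) (Metric.closedBall y m) < ∞ :=
    ae_all_iff.2 fun m => h.parent.ae_count_lt_top Metric.isClosed_closedBall.measurableSet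
      (parentIntensity_ne_top _ _ _)
  filter_upwards [h.parent_injective, h.ae_daughter_finite, h1, h2] with ω a b c d r
  exact finite_iUnion_clusters a b c y d r

/-- The number of points of the cluster process in the closed ball of radius `r` around `y`. -/
def ballCount (X : ℕ → Ω → EuclideanSpace ℝ (Fin n)) (C : ℕ → Ω → Set (EuclideanSpace ℝ (Fin n)))
    (y : EuclideanSpace ℝ (Fin n)) (r : ℝ) (ω : Ω) : ℝ≥0∞ :=
  ∑' i, clusterCount y r (X i ω) (configMeasure (C i ω))

theorem measurable_clusterCount_comp (h : IsMaternClustering X C lamP lamD rd P)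
    (y : EuclideanSpace ℝ (Fin n)) (r : ℝ) (i : ℕ) :
    Measurable fun ω => clusterCount y r (X i ω) (configMeasure (C i ω)) :=
  (measurable_clusterCount y r).comp ((h.measurable_parent i).prodMk (h.daughter i).measurable)

theorem measurable_ballCount (h : IsMaternClustering X C lamP lamD rd P)
    (y : EuclideanSpace ℝ (Fin n)) (r : ℝ) : Measurable (ballCount X C y r) :=
  Measurable.tsum fun i => h.measurable_clusterCount_comp y r i

theorem ae_encard_eq_ballCount [IsProbabilityMeasure P] [NeZero n]
    (h : IsMaternClustering X C lamP lamD rd P)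
    (y : EuclideanSpace ℝ (Fin n)) : ∀ᵐ ω ∂P, ∀ r : ℝ,
      ((((⋃ i, (fun z => X i ω + z) '' C i ω) ∩ Metric.closedBall y r).encard : ℕ∞) : ℝ≥0∞) =
        ballCount X C y r ω := by
  filter_upwards [h.ae_daughter_finite, h.ae_disjoint_clusters] with ω h1 h2 r
  exact encard_iUnion_clusters h1 h2 y r

end IsMaternClustering

/-! ### The Laplace transform of the number of points in a ball. -/

namespace IsMaternClustering

variable {Ω : Type*} [MeasurableSpace Ω] {P : Measure Ω} {n : ℕ} {lamP lamD rd : ℝ}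
  {X : ℕ → Ω → EuclideanSpace ℝ (Fin n)} {C : ℕ → Ω → Set (EuclideanSpace ℝ (Fin n))}

theorem daughterIntensity_real_closedBall [NeZero n] (hD : 0 ≤ lamD)
    (rd r : ℝ) (v : EuclideanSpace ℝ (Fin n)) :
    (ENNReal.ofReal lamD • (volume : Measure (EuclideanSpace ℝ (Fin n))).restrict
      (Metric.closedBall 0 rd)).real (Metric.closedBall v r) =
      lamD * interVolume n r rd ‖v‖ := by
  rw [measureReal_ennreal_smul_apply, ENNReal.toReal_ofReal hD,
    measureReal_restrict_apply Metric.isClosed_closedBall.measurableSet,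
    volume_real_closedBall_inter_closedBall]

/-- The count of one cluster with a fixed parent is Poisson. Its transform is kept in the form
`expNeg` of an extended number so that the product over parents becomes `expNeg` of a sum. -/
theorem integral_expNeg_mul_clusterCount [NeZero n] (h : IsMaternClustering X C lamP lamD rd P)
    (hD : 0 ≤ lamD) (y x : EuclideanSpace ℝ (Fin n)) (r : ℝ) (i : ℕ) (t : ℝ≥0∞) :
    ∫ ω, expNeg (t * clusterCount y r x (configMeasure (C i ω))) ∂P =
      expNeg (ENNReal.ofReal ((1 - expNeg t) * (lamD * interVolume n r rd ‖y - x‖))) := by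
  rw [expNeg_ofReal (mul_nonneg (one_sub_expNeg_nonneg t)
    (mul_nonneg hD (interVolume_nonneg n r rd _))),
    ← daughterIntensity_real_closedBall hD, ← (h.daughter i).integral_expNeg_mul_count
      Metric.isClosed_closedBall.measurableSet (daughterIntensity_ne_top _ _ _)]
  refine integral_congr_ae ?_
  filter_upwards [h.ae_daughter_finite] with ω hω
  rw [clusterCount, finiteMeasureKernel_apply (hω i)]

/-- Conditioning on the parents turns the number of points in a ball into a sum over the parents. -/
theorem integral_expNeg_sum_clusterCount [IsProbabilityMeasure P] [NeZero n]
    (h : IsMaternClustering X C lamP lamD rd P)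
    (hD : 0 ≤ lamD) (y : EuclideanSpace ℝ (Fin n)) (r : ℝ) (t : ℝ≥0∞) (K : ℕ) :
    ∫ ω, expNeg (t * ∑ i ∈ Finset.range K, clusterCount y r (X i ω) (configMeasure (C i ω))) ∂P =
      ∫ ω, expNeg (∑ i ∈ Finset.range K,
        ENNReal.ofReal ((1 - expNeg t) * (lamD * interVolume n r rd ‖y - X i ω‖))) ∂P := by
  have hM : ∀ i, Measurable fun ω => configMeasure (C i ω) := fun i => (h.daughter i).measurable
  have hF : Measurable fun q : (ℕ → EuclideanSpace ℝ (Fin n)) ×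
      (ℕ → Measure (EuclideanSpace ℝ (Fin n))) =>
      expNeg (t * ∑ i ∈ Finset.range K, clusterCount y r (q.1 i) (q.2 i)) := by
    refine (measurable_expNeg_const_mul t).comp (Finset.measurable_sum _ fun i _ => ?_)
    exact (measurable_clusterCount y r).comp
      (f := fun q : (ℕ → EuclideanSpace ℝ (Fin n)) ×
        (ℕ → Measure (EuclideanSpace ℝ (Fin n))) => (q.1 i, q.2 i)) (by fun_prop)
  rw [h.parent_indep_daughter.integral_prodMk (measurable_pi_lambda _ h.measurable_parent)
    (measurable_pi_lambda _ hM) hF fun q => norm_expNeg_le_one _]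
  refine integral_congr_ae (ae_of_all _ fun ω => ?_)
  simp only [Finset.mul_sum, expNeg_sum]
  -- The products are reindexed by `Fin K` to apply independence of the first `K` daughter
  -- processes.
  simp_rw [← fun ω' => Fin.prod_univ_eq_prod_range
    (fun i => expNeg (t * clusterCount y r (X i ω) (configMeasure (C i ω')))) K]
  rw [← Fin.prod_univ_eq_prod_range (fun i => expNeg (ENNReal.ofReal
    ((1 - expNeg t) * (lamD * interVolume n r rd ‖y - X i ω‖)))) K,
    (h.daughter_indep.precomp (g := fun i : Fin K => (i : ℕ))
      Fin.val_injective).integral_fun_prod_comp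
      (f := fun (i : Fin K) μ => expNeg (t * clusterCount y r (X i ω) μ))
      (fun i => (hM i).aemeasurable)
      (fun i => ((measurable_expNeg_const_mul t).comp ((measurable_clusterCount y r).comp
        measurable_prodMk_left)).aestronglyMeasurable)]
  exact Finset.prod_congr rfl fun i _ => h.integral_expNeg_mul_clusterCount hD y (X i ω) r i t

theorem tendsto_integral_expNeg_sum [IsProbabilityMeasure P] {u : ℕ → Ω → ℝ≥0∞}
    (hu : ∀ i, Measurable (u i)) {t : ℝ≥0∞} (ht : t ≠ ∞) :
    Tendsto (fun K => ∫ ω, expNeg (t * ∑ i ∈ Finset.range K, u i ω) ∂P) atTop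
      (𝓝 (∫ ω, expNeg (t * ∑' i, u i ω) ∂P)) := by
  refine tendsto_integral_of_dominated_convergence (fun _ => 1) (fun K => ?_)
    (integrable_const 1) (fun K => ae_of_all _ fun ω => norm_expNeg_le_one _)
    (ae_of_all _ fun ω => ?_)
  · exact ((measurable_expNeg_const_mul t).comp
      (Finset.measurable_sum _ fun i _ => hu i)).aestronglyMeasurable
  · exact ((continuous_expNeg.comp (ENNReal.continuous_const_mul ht)).tendsto _).comp
      ENNReal.summable.hasSum.tendsto_sum_nat

theorem measurable_ofReal_mul_interVolume [NeZero n] (c r : ℝ) (y : EuclideanSpace ℝ (Fin n)) :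
    Measurable fun x : EuclideanSpace ℝ (Fin n) =>
      ENNReal.ofReal (c * (lamD * interVolume n r rd ‖y - x‖)) := by
  have hm := measurable_interVolume n r rd
  exact ENNReal.measurable_ofReal.comp
    (((hm.comp (by fun_prop : Measurable fun x => ‖y - x‖)).const_mul lamD).const_mul c)

/-- The Laplace transform of the number of points of a Matérn cluster process in a ball. -/
theorem integral_expNeg_mul_ballCount [IsProbabilityMeasure P] [NeZero n]
    (h : IsMaternClustering X C lamP lamD rd P) (hP : 0 ≤ lamP) (hD : 0 ≤ lamD) (hrd : 0 ≤ rd)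
    (y : EuclideanSpace ℝ (Fin n)) {r : ℝ} (hr : 0 ≤ r) {t : ℝ≥0∞} (ht : t ≠ ∞) :
    ∫ ω, expNeg (t * ballCount X C y r ω) ∂P =
      Real.exp (-(lamP * unitBallVolume n * (r + rd) ^ n) +
        hGenFun n lamP lamD rd r (expNeg t)) := by
  set f : EuclideanSpace ℝ (Fin n) → ℝ≥0∞ := fun x =>
    ENNReal.ofReal ((1 - expNeg t) * (lamD * interVolume n r rd ‖y - x‖))
  have hf : Measurable f := measurable_ofReal_mul_interVolume _ _ _
  -- Conditioning was done for finitely many clusters; both sides of that identity now pass to the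
  -- limit.
  have h1 := tendsto_integral_expNeg_sum (P := P) (t := t)
    (fun i => h.measurable_clusterCount_comp y r i) ht
  have h2 := tendsto_integral_expNeg_sum (P := P) (t := 1)
    (fun i => hf.comp (h.measurable_parent i)) ENNReal.one_ne_top
  simp_rw [h.integral_expNeg_sum_clusterCount hD y r t] at h1
  simp only [one_mul, Function.comp_apply] at h2
  have h3 := tendsto_nhds_unique h1 h2
  have h4 : ∫ ω, expNeg (∑' i, f (X i ω)) ∂P =
      ∫ ω, expNeg (∫⁻ x, f x ∂configMeasure (Set.range fun i => X i ω)) ∂P := by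
    refine integral_congr_ae ?_
    filter_upwards [h.parent_injective] with ω hω
    rw [lintegral_configMeasure_range hω hf]
  have h5 : ∀ x ∉ Metric.closedBall y (r + rd), f x = 0 := by
    intro x hx
    rw [Metric.mem_closedBall, not_le, dist_comm, dist_eq_norm] at hx
    simp [f, interVolume_eq_zero n hx]
  change ∫ ω, expNeg (t * ∑' i, clusterCount y r (X i ω) (configMeasure (C i ω))) ∂P = _
  rw [h3, h4, h.parent.integral_expNeg_lintegral hf Metric.isClosed_closedBall.measurableSet
    (parentIntensity_ne_top _ _ _) h5]
  have h6 : ∀ x, expNeg (f x) =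
      Real.exp (-((1 - expNeg t) * (lamD * interVolume n r rd ‖y - x‖))) := fun x =>
    expNeg_ofReal (mul_nonneg (one_sub_expNeg_nonneg t)
      (mul_nonneg hD (interVolume_nonneg n r rd _)))
  simp_rw [h6]
  rw [integral_one_sub_exp_interVolume n hP hD hrd hr (one_sub_expNeg_nonneg t), sub_sub_cancel]
  congr 1; ring

end IsMaternClustering

/-! ### From the generating function to the distribution. -/

/-- A random natural number whose generating function is `exp (c + ∑ a_j s^j)` has the
probabilities given by the coefficients of that power series. -/
theorem measureReal_eq_of_genFun {Ω : Type*} [MeasurableSpace Ω] {P : Measure Ω}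
    [IsProbabilityMeasure P] {N : Ω → ℕ} (hN : Measurable N) {a : ℕ → ℝ} {H : ℝ → ℝ} {c : ℝ}
    (hH : ∀ s, HasSum (fun j => a j * s ^ j) (H s))
    (hNH : ∀ s : ℝ, 0 < s → s < 1 → ∫ ω, s ^ N ω ∂P = Real.exp (c + H s)) (m : ℕ) :
    P.real (N ⁻¹' {m}) = Real.exp (c + a 0) *
      ∑ b ∈ tupleSet m, ∏ i : Fin m, a ((i : ℕ) + 1) ^ b i / (b i).factorial := by
  have : IsProbabilityMeasure (P.map N) := Measure.isProbabilityMeasure_map hN.aemeasurable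
  have hp : ∀ m, (P.map N).real {m} = P.real (N ⁻¹' {m}) := fun m =>
    map_measureReal_apply hN (measurableSet_singleton m)
  have hG : ∀ s : ℝ, |s| < 1 →
      HasSum (fun m => P.real (N ⁻¹' {m}) * s ^ m) (∑' m, P.real (N ⁻¹' {m}) * s ^ m) := by
    intro s hs
    refine (Summable.of_norm_bounded (summable_geometric_of_abs_lt_one
      (r := |s|) (by rwa [abs_abs])) fun m => ?_).hasSum
    rw [norm_mul, norm_pow, Real.norm_eq_abs s, Real.norm_of_nonneg measureReal_nonneg]
    exact mul_le_of_le_one_left (by positivity) measureReal_le_one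
  refine coeff_exp_powerSeries (p := fun m => P.real (N ⁻¹' {m}))
    (G := fun s => ∑' m, P.real (N ⁻¹' {m}) * s ^ m) (H := H) ?_ (Eventually.of_forall hH) ?_ m
  · filter_upwards [Ioo_mem_nhds (neg_one_lt_zero : (-1 : ℝ) < 0) one_pos] with s hs
    exact hG s (abs_lt.2 hs)
  · filter_upwards [Ioo_mem_nhdsGT (one_pos : (0 : ℝ) < 1)] with s hs
    have hb : ∀ j : ℕ, ‖s ^ j‖ ≤ 1 := fun j => by
      rw [norm_pow, Real.norm_of_nonneg hs.1.le]
      exact pow_le_one₀ hs.1.le hs.2.le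
    rw [← hNH s hs.1 hs.2, ← integral_map (f := fun j : ℕ => s ^ j) hN.aemeasurable (by fun_prop),
      integral_countable (Integrable.of_bound (by fun_prop) 1 (ae_of_all _ hb))]
    simp_rw [hp, smul_eq_mul]

end

theorem theorem2 {Ω : Type*} [MeasurableSpace Ω] (P : Measure Ω) [IsProbabilityMeasure P]
    (n : ℕ) [NeZero n] (lamP lamD rd : ℝ) (hlamP : 0 < lamP) (hlamD : 0 < lamD) (hrd : 0 < rd)
    (Φ : Ω → Set (EuclideanSpace ℝ (Fin n)))
    (hΦ : IsMaternClusterProcess Φ lamP lamD rd P)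
    (y : EuclideanSpace ℝ (Fin n)) (k : ℕ) (hk : 1 ≤ k) :
    AEMeasurable (fun ω => kthDist k y (Φ ω)) P ∧
    ∀ r : ℝ, 0 ≤ r →
      P.real {ω | kthDist k y (Φ ω) ≤ ENNReal.ofReal r} =
        1 - Real.exp (hCoeff n lamP lamD rd 0 r - lamP * unitBallVolume n * (r + rd) ^ n) *
          ∑ m ∈ Finset.range k, ∑ b ∈ tupleSet m,
            ∏ i : Fin m, hCoeff n lamP lamD rd ((i : ℕ) + 1) r ^ b i / (b i).factorial := by
  obtain ⟨X, C, h, hΦ'⟩ := hΦ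
  have hcount : ∀ᵐ ω ∂P, ∀ r : ℝ,
      (((Φ ω ∩ Metric.closedBall y r).encard : ℕ∞) : ℝ≥0∞) =
        IsMaternClustering.ballCount X C y r ω := by
    filter_upwards [hΦ', h.ae_encard_eq_ballCount y] with ω h1 h2
    rwa [h1]
  have hfin : ∀ᵐ ω ∂P, ∀ r : ℝ, (Φ ω ∩ Metric.closedBall y r).Finite := by
    filter_upwards [hΦ', h.ae_locallyFinite y] with ω h1 h2
    rwa [h1]
  refine ⟨aemeasurable_kthDist (fun r => h.measurable_ballCount y r)
    (fun r => hcount.mono fun ω hω => hω r) hfin, fun r hr => ?_⟩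
  -- An everywhere measurable natural-valued version of the count; on the null set where the count
  -- is infinite it takes the value `0`.
  set N : Ω → ℕ := fun ω => ⌊(IsMaternClustering.ballCount X C y r ω).toReal⌋₊
  have hN : Measurable N :=
    Nat.measurable_floor.comp (h.measurable_ballCount y r).ennreal_toReal
  have hNcount : ∀ᵐ ω ∂P, (Φ ω ∩ Metric.closedBall y r).encard = N ω ∧
      IsMaternClustering.ballCount X C y r ω = N ω := by
    filter_upwards [hcount, hfin] with ω h1 h2
    have h3 := (h2 r).encard_eq_coe_toFinset_card
    have h4 : IsMaternClustering.ballCount X C y r ω = (h2 r).toFinset.card := by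
      rw [← h1 r, h3]; simp
    have h5 : N ω = (h2 r).toFinset.card := by simp [N, h4]
    rw [h5]
    exact ⟨h3, h4⟩
  have hprob := measureReal_eq_of_genFun hN (H := hGenFun n lamP lamD rd r)
    (c := -(lamP * unitBallVolume n * (r + rd) ^ n))
    (fun s => hasSum_hCoeff n lamP hlamD.le hrd.le hr s) fun s hs0 hs1 => by
      have ht : 0 ≤ -Real.log s := by linarith [Real.log_nonpos hs0.le hs1.le]
      -- The choice `t = -log s` turns the Laplace transform at `t` into the generating function at
      -- `s`.
      have hts : expNeg (ENNReal.ofReal (-Real.log s)) = s := by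
        rw [expNeg_ofReal ht, neg_neg, Real.exp_log hs0]
      have h1 := h.integral_expNeg_mul_ballCount hlamP.le hlamD.le hrd.le y hr
        (t := ENNReal.ofReal (-Real.log s)) ENNReal.ofReal_ne_top
      rw [hts] at h1
      rw [← h1]
      refine integral_congr_ae (hNcount.mono fun ω hω => ?_)
      beta_reduce
      rw [hω.2, expNeg_mul_natCast, hts]
  have hset : P.real {ω | kthDist k y (Φ ω) ≤ ENNReal.ofReal r} =
      P.real (N ⁻¹' (Finset.range k : Set ℕ))ᶜ := by
    refine measureReal_congr ?_
    filter_upwards [hNcount, hfin] with ω h1 h2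
    refine propext ((kthDist_le_ofReal_iff h2 k hr).trans ?_)
    rw [h1.1]
    change _ ↔ ¬ (N ω ∈ (Finset.range k : Set ℕ))
    simp
  rw [hset, probReal_compl_eq_one_sub (hN (Finset.measurableSet _)),
    ← sum_measureReal_preimage_singleton _ fun m _ => hN (measurableSet_singleton m),
    Finset.mul_sum]
  congr 1
  refine Finset.sum_congr rfl fun m _ => ?_
  rw [hprob m, neg_add_eq_sub]
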